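/- All manifolds are Hausdorff, paracompact, connected and $C^\infty$. Let $(M,\nabla)$ and $(\widetilde M,\widetilde\nabla)$ be $n$-manifolds with smooth linear connections (torsion is allowed). Geodesics are nonconstant solutions $\gamma$ of $\nabla_{\gamma'}\gamma'=0$ on open intervals, and are inextendible. Let $T'M$ be $TM$ without its zero section, let $PM$ be the quotient of $T'M$ by proportionality of vectors at the same point, and let the space of geodesics $G(M)$ be the topological quotient of $PM$ that identifies points lying on the lift of a common geodesic; similarly for $\widetilde M$. Call $(M,\nabla)$ *nonreturning* if each point of $M$ has arbitrarily small neighbourhoods $U$ such that no geodesic that leaves $U$ ever returns to $U$ (that is, $\gamma^{-1}(U)$ is an interval, possibly empty, for every geodesic $\gamma$). Let $p:\widetilde M\to M$ be a geodesic covering, that is, a surjective covering map that is a local diffeomorphism and takes the image of each geodesic of $(\widetilde M,\widetilde\nabla)$ onto the image of a geodesic of $(M,\nabla)$. Suppose that $(M,\nabla)$ is nonreturning. If $G(M)$ is a manifold, then $G(\widetilde M)$ is also a manifold. This holds in both senses of the word: (a) if $G(M)$ is a topological manifold (Hausdorff, paracompact, connected and locally Euclidean), then so is $G(\widetilde M)$;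 (b) if moreover $G(M)$ has a $C^\infty$ structure for which the natural projection $T'M\to G(M)$ is a smooth submersion, then $G(\widetilde M)$ is a topological manifold with a $C^\infty$ structure for which $T'\widetilde M\to G(\widetilde M)$ is a smooth submersion. -/

import Mathlib

open Set Topology Bundle
open scoped Manifold ContDiff

noncomputable section

namespace GeodesicSpaces

variable {n : ℕ} {M : Type*} [TopologicalSpace M]
  [ChartedSpace (EuclideanSpace ℝ (Fin n)) M] [IsManifold (𝓡 n) ∞ M]

/-- A linear connection on `M`: a covariant derivative on the tangent bundle. Smoothness is the
separate class `CovariantDerivative.ContMDiffCovariantDerivative _ ∞`; torsion is allowed. -/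
abbrev LinearConnection (n : ℕ) (M : Type*) [TopologicalSpace M]
    [ChartedSpace (EuclideanSpace ℝ (Fin n)) M] [IsManifold (𝓡 n) ∞ M] :=
  CovariantDerivative (𝓡 n) (EuclideanSpace ℝ (Fin n))
    (fun x : M => TangentSpace (𝓡 n) x)

/-- The velocity `γ'(t)`. -/
def velocity (γ : ℝ → M) (t : ℝ) : TangentSpace (𝓡 n) (γ t) :=
  mfderiv 𝓘(ℝ, ℝ) (𝓡 n) γ t (1 : ℝ)

/-- The vector field that, in the chart at `x₀`, has constant coordinates `w`
(extended by `0` outside the domain of that chart). -/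
def coordField (x₀ : M) (w : EuclideanSpace ℝ (Fin n)) (x : M) : TangentSpace (𝓡 n) x :=
  (trivializationAt (EuclideanSpace ℝ (Fin n)) (fun x : M => TangentSpace (𝓡 n) x) x₀).symm x w

/-- The coordinates of the tangent vector `v` at `x` in the chart at `x₀`. -/
def coordVec (x₀ x : M) (v : TangentSpace (𝓡 n) x) : EuclideanSpace ℝ (Fin n) :=
  (trivializationAt (EuclideanSpace ℝ (Fin n)) (fun x : M => TangentSpace (𝓡 n) x) x₀ ⟨x, v⟩).2

/-- `γ` solves the geodesic equation on the open interval `J` and is not constant.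
In the chart at `x₀` the equation reads `c'' + Γ(c', c') = 0`, where `c` is `γ` in coordinates and
`Γ(v, w)` is `∇_v` of the vector field with constant coordinates `w`. A solution is constant as
soon as its velocity vanishes once, hence the condition on the velocity. -/
structure IsGeodesicOn (cov : LinearConnection n M) (γ : ℝ → M) (J : Set ℝ) : Prop where
  isOpen : IsOpen J
  ordConnected : J.OrdConnected
  nonempty : J.Nonempty
  contMDiffOn : ContMDiffOn 𝓘(ℝ, ℝ) (𝓡 n) 2 γ J
  velocity_ne_zero : ∀ t ∈ J, velocity γ t ≠ (0 : TangentSpace (𝓡 n) (γ t))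
  equation : ∀ t ∈ J, ∀ x₀ : M, γ t ∈ (chartAt (EuclideanSpace ℝ (Fin n)) x₀).source →
    deriv (deriv (fun s => extChartAt (𝓡 n) x₀ (γ s))) t +
      coordVec x₀ (γ t)
        (cov (coordField x₀ (deriv (fun s => extChartAt (𝓡 n) x₀ (γ s)) t)) (γ t)
          (velocity γ t)) = 0

/-- `γ : J → M` is an inextendible geodesic. -/
def IsGeodesic (cov : LinearConnection n M) (γ : ℝ → M) (J : Set ℝ) : Prop :=
  IsGeodesicOn cov γ J ∧
    ∀ (γ' : ℝ → M) (J' : Set ℝ), IsGeodesicOn cov γ' J' → J ⊆ J' → EqOn γ' γ J → J' = J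

/-- `(M, ∇)` is nonreturning: every point has arbitrarily small neighbourhoods to which no geodesic
returns after having left them. -/
def Nonreturning (cov : LinearConnection n M) : Prop :=
  ∀ x : M, ∀ V ∈ 𝓝 x, ∃ U ∈ 𝓝 x, U ⊆ V ∧
    ∀ (γ : ℝ → M) (J : Set ℝ), IsGeodesic cov γ J → (J ∩ γ ⁻¹' U).OrdConnected

variable (n M) in
/-- The reduced tangent bundle `T'M`: the tangent bundle without its zero section, an open
submanifold of `TM`. -/
def ReducedTangentBundle : TopologicalSpace.Opens (TangentBundle (𝓡 n) M) where
  carrier := {v | v.2 ≠ 0}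
  is_open' := by
    rw [isOpen_iff_mem_nhds]
    intro v hv
    let e := trivializationAt (EuclideanSpace ℝ (Fin n))
      (fun x : M => TangentSpace (𝓡 n) x) v.1
    have key : ∀ u ∈ e.source, (e u).2 = 0 ↔ u.2 = 0 := by
      intro u hu
      have hb : u.1 ∈ e.baseSet := (e.mem_source).1 hu
      have h1 : (e u).2 = e.continuousLinearEquivAt ℝ u.1 hb u.2 := by
        simp [Trivialization.continuousLinearEquivAt_apply]
      rw [h1]
      exact (e.continuousLinearEquivAt ℝ u.1 hb).map_eq_zero_iff
    have hv' : v ∈ e.source :=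
      (e.mem_source).2 (FiberBundle.mem_baseSet_trivializationAt' v.1)
    have hc : ContinuousAt (fun u => (e u).2) v :=
      continuous_snd.continuousAt.comp (e.continuousOn.continuousAt (e.open_source.mem_nhds hv'))
    have h2 : ∀ᶠ u in 𝓝 v, (e u).2 ≠ 0 :=
      hc.eventually_ne (fun h => hv ((key v hv').1 h))
    filter_upwards [h2, e.open_source.mem_nhds hv'] with u hu hus h
    exact hu ((key u hus).2 h)

variable (n M) in
/-- Proportionality of nonzero tangent vectors at the same point. -/
def proportional : Setoid (ReducedTangentBundle n M) where
  r u v := ∃ c : ℝ, c ≠ 0 ∧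
    v.1 = (⟨u.1.1, c • u.1.2⟩ : TangentBundle (𝓡 n) M)
  iseqv := by
    refine ⟨fun u => ⟨1, one_ne_zero, by rw [one_smul]⟩, ?_, ?_⟩
    · rintro ⟨⟨x, u⟩, hu⟩ ⟨v, hv⟩ ⟨c, hc, h⟩
      obtain rfl := h
      exact ⟨c⁻¹, inv_ne_zero hc, by simp [smul_smul, hc]⟩
    · rintro ⟨⟨x, u⟩, hu⟩ ⟨v, hv⟩ ⟨w, hw⟩ ⟨c, hc, h⟩ ⟨d, hd, h'⟩
      obtain rfl := h
      obtain rfl := h'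
      exact ⟨d * c, mul_ne_zero hd hc, by simp [smul_smul]⟩

variable (n M) in
/-- The projectivised tangent bundle `PM`, with the quotient topology. -/
abbrev ProjectiveTangentBundle := Quotient (proportional n M)

/-- Two tangent lines that both lie on the lift to `PM` of a common geodesic. -/
def OnCommonGeodesic (cov : LinearConnection n M) (a b : ProjectiveTangentBundle n M) : Prop :=
  ∃ (γ : ℝ → M) (J : Set ℝ), IsGeodesic cov γ J ∧ ∃ s ∈ J, ∃ t ∈ J,
    ∃ u v : ReducedTangentBundle n M,
      u.1 = (⟨γ s, velocity γ s⟩ : TangentBundle (𝓡 n) M) ∧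
      v.1 = (⟨γ t, velocity γ t⟩ : TangentBundle (𝓡 n) M) ∧
      Quotient.mk _ u = a ∧ Quotient.mk _ v = b

/-- The space of (unoriented) geodesics `G(M)`: the topological quotient of `PM` that identifies
tangent lines on the lift of a common geodesic. -/
abbrev GeodesicSpace (cov : LinearConnection n M) := Quot (OnCommonGeodesic cov)

/-- The natural projection `T'M → G(M)`. -/
def toGeodesicSpace (cov : LinearConnection n M) (v : ReducedTangentBundle n M) :
    GeodesicSpace cov :=
  Quot.mk _ (Quotient.mk _ v)

/-- A topological manifold: a Hausdorff, paracompact, connected, locally Euclidean space. -/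
structure IsTopologicalManifold (X : Type*) [TopologicalSpace X] : Prop where
  t2 : T2Space X
  paracompact : ParacompactSpace X
  connected : ConnectedSpace X
  locallyEuclidean : ∃ m : ℕ, Nonempty (ChartedSpace (EuclideanSpace ℝ (Fin m)) X)

/-- `G(M)` is a manifold in the smooth sense: a topological manifold carrying a smooth structure
for which the natural projection `T'M → G(M)` is a smooth submersion. -/
def GeodesicSpaceIsSmoothManifold (cov : LinearConnection n M) : Prop :=
  IsTopologicalManifold (GeodesicSpace cov) ∧
  ∃ (m : ℕ) (_ : ChartedSpace (EuclideanSpace ℝ (Fin m)) (GeodesicSpace cov)),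
    IsManifold (𝓡 m) ∞ (GeodesicSpace cov) ∧
    ContMDiff (𝓡 n).tangent (𝓡 m) ∞ (toGeodesicSpace cov) ∧
    ∀ v, Function.Surjective (mfderiv (𝓡 n).tangent (𝓡 m) (toGeodesicSpace cov) v)

/-- A geodesic covering map: a smooth covering that takes the image of each (inextendible) geodesic
onto the image of a geodesic. -/
structure IsGeodesicCovering {M' : Type*} [TopologicalSpace M']
    [ChartedSpace (EuclideanSpace ℝ (Fin n)) M'] [IsManifold (𝓡 n) ∞ M']
    (cov' : LinearConnection n M') (cov : LinearConnection n M) (p : M' → M) : Prop where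
  isCoveringMap : IsCoveringMap p
  surjective : Function.Surjective p
  isLocalDiffeomorph : IsLocalDiffeomorph (𝓡 n) (𝓡 n) ∞ p
  image_geodesic : ∀ (γ' : ℝ → M') (J' : Set ℝ), IsGeodesic cov' γ' J' →
    ∃ (γ : ℝ → M) (J : Set ℝ), IsGeodesic cov γ J ∧ p '' (γ' '' J') = γ '' J

end GeodesicSpaces

end

/-! The covering `p` induces a map `P : G(M') → G(M)` (`geodesicSpaceMap`) with `P ∘ π' = π ∘ dp`,
where `π`, `π'` are the projections from the reduced tangent bundles. The theorem follows once `P`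
is known to be a local homeomorphism and `G(M')` to be Hausdorff.

Nonreturning enters twice. First, geodesics of `M` are injective, and nearness in `M` forces
nearness in time (`Nonreturning.exists_nhds_subset_Ioo`). The hypothesis on `p`, which speaks only
of images, therefore becomes a statement about curves: `p ∘ γ'` is a differentiable, strictly
monotone reparametrisation of an entire geodesic `γ` (`IsGeodesicCovering.exists_covers`). Second,
over an evenly covered nonreturning set `U` the times which a geodesic of `M'` spends above `U` form
an interval, so it stays in one sheet (`IsGeodesicCovering.sheet_eq`).

Suppose now that `dp u` and `dp v` are tangent to one geodesic of `M`. The geodesic through `v`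
covers all of it, hence passes over the base point of `u`; if it does so at that base point, it is
tangent to `u` (`IsGeodesicCovering.exists_over`). When `u` and `v` lie in one sheet over `U` this
must happen, so `P` is locally injective; it is continuous and open because `π`, `π'` and `dp` are.
When two distinct geodesics have the same image under `P`, they pass over a common point in
different sheets, and the tangent vectors of these sheets have disjoint open images in `G(M')`. This
gives Hausdorffness for pairs in one fibre of `P`; other pairs are separated in `G(M)`.

Openness of `π` rests on continuous dependence of geodesics on initial velocities
(`IsGeodesic.lift_mem_interior`, `isOpenMap_toGeodesicSpace`). It makes `G(M')` second countable,
hence paracompact once it is locally compact Hausdorff; connectedness comes from that of `M'`. In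
the smooth case charts are pulled back along `P`, and both smoothness and submersivity of `π'` are
read off from `P ∘ π' = π ∘ dp`. -/

set_option linter.unusedSectionVars false

noncomputable section

namespace GeodesicSpaces

variable {n : ℕ} {M : Type*} [TopologicalSpace M]
  [ChartedSpace (EuclideanSpace ℝ (Fin n)) M] [IsManifold (𝓡 n) ∞ M]

local notation "𝔼" => EuclideanSpace ℝ (Fin n)

/-! ### Tangent vectors and vector fields in a chart -/

section Coordinates

lemma mem_trivializationAt_baseSet {x₀ x : M} (hx : x ∈ (chartAt 𝔼 x₀).source) :
    x ∈ (trivializationAt 𝔼 (fun x : M => TangentSpace (𝓡 n) x) x₀).baseSet := by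
  simpa using hx

lemma coordVec_coordField {x₀ x : M} (hx : x ∈ (chartAt 𝔼 x₀).source) (w : 𝔼) :
    coordVec x₀ x (coordField x₀ w x) = w :=
  congrArg Prod.snd ((trivializationAt 𝔼 (fun x : M => TangentSpace (𝓡 n) x) x₀).apply_mk_symm
    (mem_trivializationAt_baseSet hx) w)

lemma coordField_coordVec {x₀ x : M} (hx : x ∈ (chartAt 𝔼 x₀).source)
    (v : TangentSpace (𝓡 n) x) : coordField x₀ (coordVec x₀ x v) x = v :=
  (trivializationAt 𝔼 (fun x : M => TangentSpace (𝓡 n) x) x₀).symm_apply_apply_mk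
    (mem_trivializationAt_baseSet hx) v

lemma coordVec_eq {x₀ x : M} (hx : x ∈ (chartAt 𝔼 x₀).source)
    (v : TangentSpace (𝓡 n) x) : coordVec x₀ x v =
      (trivializationAt 𝔼 (fun x : M => TangentSpace (𝓡 n) x) x₀).continuousLinearMapAt ℝ x v :=
  ((trivializationAt 𝔼 (fun x : M => TangentSpace (𝓡 n) x) x₀).continuousLinearMapAt_apply_of_mem
    (R := ℝ) (mem_trivializationAt_baseSet hx) (y := v)).symm

lemma coordField_eq {x₀ x : M} (hx : x ∈ (chartAt 𝔼 x₀).source) (w : 𝔼) :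
    coordField x₀ w x =
      (trivializationAt 𝔼 (fun x : M => TangentSpace (𝓡 n) x) x₀).symmL ℝ x w :=
  ((trivializationAt 𝔼 (fun x : M => TangentSpace (𝓡 n) x) x₀).symmL_apply (R := ℝ)
    (mem_trivializationAt_baseSet hx) w).symm

lemma coordVec_add {x₀ x : M} (hx : x ∈ (chartAt 𝔼 x₀).source)
    (v w : TangentSpace (𝓡 n) x) : coordVec x₀ x (v + w) = coordVec x₀ x v + coordVec x₀ x w := by
  rw [coordVec_eq hx, coordVec_eq hx, coordVec_eq hx, map_add]

lemma coordVec_smul {x₀ x : M} (hx : x ∈ (chartAt 𝔼 x₀).source) (c : ℝ)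
    (v : TangentSpace (𝓡 n) x) : coordVec x₀ x (c • v) = c • coordVec x₀ x v := by
  rw [coordVec_eq hx, coordVec_eq hx, map_smul]

lemma coordVec_eq_zero_iff {x₀ x : M} (hx : x ∈ (chartAt 𝔼 x₀).source)
    (v : TangentSpace (𝓡 n) x) : coordVec x₀ x v = 0 ↔ v = 0 := by
  constructor
  · intro h
    rw [← coordField_coordVec hx v, h, coordField_eq hx, map_zero]
  · rintro rfl
    rw [coordVec_eq hx, map_zero]

lemma coordVec_sum {x₀ x : M} (hx : x ∈ (chartAt 𝔼 x₀).source) {ι : Type*} (s : Finset ι)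
    (v : ι → TangentSpace (𝓡 n) x) :
    coordVec x₀ x (∑ i ∈ s, v i) = ∑ i ∈ s, coordVec x₀ x (v i) := by
  simp only [coordVec_eq hx, map_sum]

lemma coordField_add {x₀ x : M} (hx : x ∈ (chartAt 𝔼 x₀).source) (v w : 𝔼) :
    coordField x₀ (v + w) x = coordField x₀ v x + coordField x₀ w x := by
  rw [coordField_eq hx, coordField_eq hx, coordField_eq hx, map_add]

lemma coordField_smul {x₀ x : M} (hx : x ∈ (chartAt 𝔼 x₀).source) (c : ℝ) (v : 𝔼) :
    coordField x₀ (c • v) x = c • coordField x₀ v x := by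
  rw [coordField_eq hx, coordField_eq hx, map_smul]

lemma coordField_sum {x₀ x : M} (hx : x ∈ (chartAt 𝔼 x₀).source) {ι : Type*} (s : Finset ι)
    (w : ι → 𝔼) : coordField x₀ (∑ i ∈ s, w i) x = ∑ i ∈ s, coordField x₀ (w i) x := by
  simp only [coordField_eq hx, map_sum]

/-- A vector field is as smooth at a point as its coordinates. -/
lemma contMDiffAt_section_iff_coordVec {k : ℕ∞} {x₀ x : M} (hx : x ∈ (chartAt 𝔼 x₀).source)
    {σ : Π y : M, TangentSpace (𝓡 n) y} :
    ContMDiffAt (𝓡 n) ((𝓡 n).prod 𝓘(ℝ, 𝔼)) k (fun y => TotalSpace.mk' 𝔼 y (σ y)) x ↔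
      ContMDiffAt (𝓡 n) 𝓘(ℝ, 𝔼) k (fun y => coordVec x₀ y (σ y)) x := by
  have : ContMDiffVectorBundle (k : WithTop ℕ∞) 𝔼 (fun x : M => TangentSpace (𝓡 n) x) (𝓡 n) :=
    ContMDiffVectorBundle.of_le (n := ∞) (by exact_mod_cast le_top)
  exact (trivializationAt 𝔼 (fun x : M => TangentSpace (𝓡 n) x) x₀).contMDiffAt_section_iff
    (mem_trivializationAt_baseSet hx)

lemma mdifferentiableAt_section_iff_coordVec {x₀ x : M} (hx : x ∈ (chartAt 𝔼 x₀).source)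
    {σ : Π y : M, TangentSpace (𝓡 n) y} :
    MDifferentiableAt (𝓡 n) ((𝓡 n).prod 𝓘(ℝ, 𝔼)) (fun y => TotalSpace.mk' 𝔼 y (σ y)) x ↔
      MDifferentiableAt (𝓡 n) 𝓘(ℝ, 𝔼) (fun y => coordVec x₀ y (σ y)) x := by
  have : ContMDiffVectorBundle 1 𝔼 (fun x : M => TangentSpace (𝓡 n) x) (𝓡 n) :=
    ContMDiffVectorBundle.of_le (n := ∞) (by exact_mod_cast le_top)
  exact (trivializationAt 𝔼 (fun x : M => TangentSpace (𝓡 n) x) x₀).mdifferentiableAt_section_iff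
    (𝓡 n) σ (mem_trivializationAt_baseSet hx)

lemma contMDiffAt_coordField {k : ℕ∞} {x₀ x : M} (hx : x ∈ (chartAt 𝔼 x₀).source) (w : 𝔼) :
    ContMDiffAt (𝓡 n) ((𝓡 n).prod 𝓘(ℝ, 𝔼)) k
      (fun y => TotalSpace.mk' 𝔼 y (coordField x₀ w y)) x := by
  rw [contMDiffAt_section_iff_coordVec hx]
  refine (contMDiffAt_const (c := w)).congr_of_eventuallyEq ?_
  filter_upwards [(chartAt 𝔼 x₀).open_source.mem_nhds hx] with y hy
  exact coordVec_coordField hy w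

lemma mdifferentiableAt_coordField {x₀ x : M} (hx : x ∈ (chartAt 𝔼 x₀).source) (w : 𝔼) :
    MDifferentiableAt (𝓡 n) ((𝓡 n).prod 𝓘(ℝ, 𝔼))
      (fun y => TotalSpace.mk' 𝔼 y (coordField x₀ w y)) x :=
  (contMDiffAt_coordField (k := 1) hx w).mdifferentiableAt one_ne_zero

end Coordinates

/-! ### The connection in a chart -/

section CovariantDerivative

variable (cov : LinearConnection n M)

lemma cov_congr {σ τ : Π y : M, TangentSpace (𝓡 n) y} {x : M}
    (hσ : MDifferentiableAt (𝓡 n) ((𝓡 n).prod 𝓘(ℝ, 𝔼)) (fun y => TotalSpace.mk' 𝔼 y (σ y)) x)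
    (hτ : MDifferentiableAt (𝓡 n) ((𝓡 n).prod 𝓘(ℝ, 𝔼)) (fun y => TotalSpace.mk' 𝔼 y (τ y)) x)
    (h : ∀ᶠ y in 𝓝 x, σ y = τ y) : cov σ x = cov τ x :=
  cov.isCovariantDerivativeOnUniv.congr_of_eventuallyEq hσ hτ Filter.univ_mem h

lemma cov_sum {ι : Type*} (s : Finset ι) (σ : ι → Π y : M, TangentSpace (𝓡 n) y) {x : M}
    (hσ : ∀ i ∈ s, MDifferentiableAt (𝓡 n) ((𝓡 n).prod 𝓘(ℝ, 𝔼))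
      (fun y => TotalSpace.mk' 𝔼 y (σ i y)) x) :
    MDifferentiableAt (𝓡 n) ((𝓡 n).prod 𝓘(ℝ, 𝔼))
      (fun y => TotalSpace.mk' 𝔼 y ((∑ i ∈ s, σ i) y)) x ∧
    cov (∑ i ∈ s, σ i) x = ∑ i ∈ s, cov (σ i) x := by
  classical
  induction s using Finset.induction_on with
  | empty =>
    refine ⟨mdifferentiableAt_zeroSection ℝ (fun x : M => TangentSpace (𝓡 n) x), ?_⟩
    rw [Finset.sum_empty, Finset.sum_empty]
    exact cov.isCovariantDerivativeOnUniv.zero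
  | insert a s ha ih =>
    obtain ⟨h1, h2⟩ := ih fun i hi => hσ i (Finset.mem_insert_of_mem hi)
    rw [Finset.sum_insert ha, Finset.sum_insert ha]
    have h3 := hσ a (Finset.mem_insert_self a s)
    refine ⟨mdifferentiableAt_add_section h3 h1, ?_⟩
    rw [cov.isCovariantDerivativeOnUniv.add h3 h1, h2]

/-- The covariant derivative of a vector field in the coordinates at `x₀`. -/
lemma coordVec_cov {x₀ x : M} (hx : x ∈ (chartAt 𝔼 x₀).source)
    {σ : Π y : M, TangentSpace (𝓡 n) y}
    (hσ : MDifferentiableAt (𝓡 n) ((𝓡 n).prod 𝓘(ℝ, 𝔼)) (fun y => TotalSpace.mk' 𝔼 y (σ y)) x)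
    (v : TangentSpace (𝓡 n) x) :
    coordVec x₀ x (cov σ x v) =
      mvfderiv (𝓡 n) (fun y => coordVec x₀ y (σ y)) x v +
        coordVec x₀ x (cov (coordField x₀ (coordVec x₀ x (σ x))) x v) := by
  have hs := (mdifferentiableAt_section_iff_coordVec hx).1 hσ
  set s : M → 𝔼 := fun y => coordVec x₀ y (σ y) with hsdef
  -- Near `x` the field is `∑ sᵢ ∂ᵢ` with coordinate fields `∂ᵢ`. The Leibniz rule splits the
  -- derivative into the derivatives of the `sᵢ` and the terms with `sᵢ` frozen at `x`; the latter
  -- form the derivative of a constant-coordinate field.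
  let b : Fin n → 𝔼 := fun i => EuclideanSpace.single i 1
  have hb : ∀ w : 𝔼, ∑ i, w i • b i = w := by
    intro w
    have := (EuclideanSpace.basisFun (Fin n) ℝ).sum_repr w
    simpa [b] using this
  have hsi : ∀ i, MDifferentiableAt (𝓡 n) 𝓘(ℝ, ℝ) (fun y => s y i) x := fun i =>
    ((EuclideanSpace.proj (𝕜 := ℝ) i : 𝔼 →L[ℝ] ℝ).mdifferentiableAt).comp x hs
  have hds : ∀ i, mvfderiv (𝓡 n) (fun y => s y i) x v = (mvfderiv (𝓡 n) s x v) i := by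
    intro i
    have h := mfderiv_comp x ((EuclideanSpace.proj (𝕜 := ℝ) i : 𝔼 →L[ℝ] ℝ).mdifferentiableAt) hs
    rw [ContinuousLinearMap.mfderiv_eq] at h
    exact congrArg (fun L => L v) h
  have hterm : ∀ i, MDifferentiableAt (𝓡 n) ((𝓡 n).prod 𝓘(ℝ, 𝔼))
      (fun y => TotalSpace.mk' 𝔼 y (((fun y => s y i) • coordField x₀ (b i)) y)) x := fun i =>
    (hsi i).smul_section (mdifferentiableAt_coordField hx (b i))
  have hsum := cov_sum cov Finset.univ (fun i => (fun y => s y i) • coordField x₀ (b i))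
    (fun i _ => hterm i)
  have hconst : ∀ i, MDifferentiableAt (𝓡 n) ((𝓡 n).prod 𝓘(ℝ, 𝔼))
      (fun y => TotalSpace.mk' 𝔼 y ((s x i • coordField x₀ (b i)) y)) x := fun i =>
    (mdifferentiableAt_coordField hx (b i)).smul_const_section
  have hsum' := cov_sum cov Finset.univ (fun i => s x i • coordField x₀ (b i))
    (fun i _ => hconst i)
  have h1 : cov σ x = ∑ i, (s x i • cov (coordField x₀ (b i)) x +
      (mvfderiv (𝓡 n) (fun y => s y i) x).smulRight (coordField x₀ (b i) x)) := by
    rw [cov_congr cov hσ hsum.1, hsum.2]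
    · refine Finset.sum_congr rfl fun i _ => ?_
      exact cov.isCovariantDerivativeOnUniv.leibniz (mdifferentiableAt_coordField hx (b i)) (hsi i)
    · filter_upwards [(chartAt 𝔼 x₀).open_source.mem_nhds hx] with y hy
      rw [← coordField_coordVec hy (σ y)]
      change coordField x₀ (s y) y = _
      rw [← hb (s y), coordField_sum hy]
      simp [coordField_smul hy]
  have h2 : cov (coordField x₀ (s x)) x = ∑ i, s x i • cov (coordField x₀ (b i)) x := by
    rw [cov_congr cov (mdifferentiableAt_coordField hx _) hsum'.1, hsum'.2]
    · refine Finset.sum_congr rfl fun i _ => ?_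
      exact cov.isCovariantDerivativeOnUniv.smul_const _ (mdifferentiableAt_coordField hx (b i))
    · filter_upwards [(chartAt 𝔼 x₀).open_source.mem_nhds hx] with y hy
      conv_lhs => rw [← hb (s x), coordField_sum hy]
      simp [coordField_smul hy]
  change _ = mvfderiv (𝓡 n) s x v + coordVec x₀ x (cov (coordField x₀ (s x)) x v)
  rw [h1, h2, Finset.sum_add_distrib]
  simp only [add_apply, sum_apply,
    ContinuousLinearMap.smulRight_apply]
  rw [add_comm, coordVec_add hx, coordVec_sum hx]
  congr 1
  simp only [coordVec_smul hx, coordVec_coordField hx]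
  simp only [hds]
  exact hb _

end CovariantDerivative

/-! ### Christoffel symbols and smoothness of the geodesic equation -/

section Spray

variable (cov : LinearConnection n M)

/-- Coordinates of `∇_V W` for the fields `V`, `W` with constant coordinates `v`, `w`. -/
def christoffel (x₀ : M) (v w : 𝔼) (x : M) : 𝔼 :=
  coordVec x₀ x (cov (coordField x₀ w) x (coordField x₀ v x))

/-- Separates the dependence on the velocities, which is polynomial, from the dependence on the
point, so that joint smoothness in both follows from smoothness of finitely many coefficients. -/
lemma christoffel_sum {x₀ x : M} (hx : x ∈ (chartAt 𝔼 x₀).source) (v w : 𝔼) :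
    christoffel cov x₀ v w x = ∑ i, ∑ j, (v i * w j) •
      christoffel cov x₀ (EuclideanSpace.single i 1) (EuclideanSpace.single j 1) x := by
  let b : Fin n → 𝔼 := fun i => EuclideanSpace.single i 1
  have hb : ∀ w : 𝔼, ∑ i, w i • b i = w := by
    intro w
    have := (EuclideanSpace.basisFun (Fin n) ℝ).sum_repr w
    simpa [b] using this
  have hd : ∀ j ∈ Finset.univ, MDifferentiableAt (𝓡 n) ((𝓡 n).prod 𝓘(ℝ, 𝔼))
      (fun y => TotalSpace.mk' 𝔼 y ((w j • coordField x₀ (b j)) y)) x := fun j _ =>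
    (mdifferentiableAt_coordField hx (b j)).smul_const_section
  have hsum := cov_sum cov Finset.univ (fun j => w j • coordField x₀ (b j)) hd
  have h1 : cov (coordField x₀ w) x = ∑ j, w j • cov (coordField x₀ (b j)) x := by
    rw [cov_congr cov (mdifferentiableAt_coordField hx _) hsum.1, hsum.2]
    · refine Finset.sum_congr rfl fun j _ => ?_
      exact cov.isCovariantDerivativeOnUniv.smul_const _ (mdifferentiableAt_coordField hx (b j))
    · filter_upwards [(chartAt 𝔼 x₀).open_source.mem_nhds hx] with y hy
      conv_lhs => rw [← hb w, coordField_sum hy]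
      simp [coordField_smul hy]
  have h2 : coordField x₀ v x = ∑ i, v i • coordField x₀ (b i) x := by
    conv_lhs => rw [← hb v, coordField_sum hx]
    simp [coordField_smul hx]
  rw [christoffel, h1, h2]
  simp only [sum_apply, map_sum, map_smul, smul_apply]
  simp only [Finset.smul_sum, coordVec_sum hx, coordVec_smul hx, smul_smul]
  rfl

/-- The acceleration that the geodesic equation prescribes in the chart at `x₀`, at the point with
coordinates `z.1` and the velocity with coordinates `z.2`. -/
def spray (x₀ : M) (z : 𝔼 × 𝔼) : 𝔼 :=
  -christoffel cov x₀ z.2 z.2 ((extChartAt (𝓡 n) x₀).symm z.1)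

variable [T2Space M]

lemma contMDiffAt_cov [CovariantDerivative.ContMDiffCovariantDerivative cov ∞] {x₀ x : M}
    (hx : x ∈ (chartAt 𝔼 x₀).source) (w : 𝔼) :
    ContMDiffAt (𝓡 n) ((𝓡 n).prod 𝓘(ℝ, 𝔼 →L[ℝ] 𝔼)) ∞
      (fun y => TotalSpace.mk' (𝔼 →L[ℝ] 𝔼)
        (E := fun y : M => TangentSpace (𝓡 n) y →L[ℝ] TangentSpace (𝓡 n) y) y
        (cov (coordField x₀ w) y)) x := by
  have hU : (chartAt 𝔼 x₀).source ∈ 𝓝 x := (chartAt 𝔼 x₀).open_source.mem_nhds hx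
  -- Smoothness of the connection is applied to globally smooth fields, but `coordField` is cut off
  -- by zero outside the chart. A bump function supported in the chart gives a global smooth field
  -- with the same germ at every point near `x`.
  obtain ⟨f, -, hf⟩ := ((SmoothBumpFunction.nhds_basis_tsupport (I := 𝓡 n) x).mem_iff).1 hU
  have hfs : ContMDiff (𝓡 n) ((𝓡 n).prod 𝓘(ℝ, 𝔼)) ∞
      (fun y => TotalSpace.mk' 𝔼 y (((f : M → ℝ) • coordField x₀ w) y)) :=
    ContMDiffOn.smul_section_of_tsupport f.contMDiff.contMDiffOn (chartAt 𝔼 x₀).open_source hf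
      fun y hy => (contMDiffAt_coordField (k := ⊤) hy w).contMDiffWithinAt
  have hcov := (CovariantDerivative.ContMDiffCovariantDerivative.contMDiff (cov := cov)
    (k := ∞)).contMDiff (σ := (f : M → ℝ) • coordField x₀ w) (by simpa using hfs.contMDiffOn)
  refine (hcov.contMDiffAt Filter.univ_mem).congr_of_eventuallyEq ?_
  filter_upwards [f.eventuallyEq_one.eventuallyEq_nhds, hU] with y hy hyU
  congr 1
  refine cov_congr cov (mdifferentiableAt_coordField hyU w)
    ((hfs y).mdifferentiableAt (by simp)) ?_
  filter_upwards [hy] with z hz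
  simp [hz]

lemma contMDiffAt_christoffel [CovariantDerivative.ContMDiffCovariantDerivative cov ∞] {x₀ x : M}
    (hx : x ∈ (chartAt 𝔼 x₀).source) (v w : 𝔼) :
    ContMDiffAt (𝓡 n) 𝓘(ℝ, 𝔼) ∞ (christoffel cov x₀ v w) x := by
  have h := (contMDiffAt_cov cov hx w).clm_bundle_apply (contMDiffAt_coordField (k := ⊤) hx v)
  exact (contMDiffAt_section_iff_coordVec (k := ⊤) hx).1 h

lemma contDiffAt_spray [CovariantDerivative.ContMDiffCovariantDerivative cov ∞] (x₀ : M)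
    {z : 𝔼 × 𝔼} (hz : z.1 ∈ (extChartAt (𝓡 n) x₀).target) :
    ContDiffAt ℝ ∞ (spray cov x₀) z := by
  have ht : IsOpen (extChartAt (𝓡 n) x₀).target := isOpen_extChartAt_target x₀
  have hmem : ∀ y ∈ (extChartAt (𝓡 n) x₀).target,
      (extChartAt (𝓡 n) x₀).symm y ∈ (chartAt 𝔼 x₀).source := fun y hy => by
    have := (extChartAt (𝓡 n) x₀).map_target hy
    rwa [extChartAt_source] at this
  have heq : spray cov x₀ =ᶠ[𝓝 z] fun z => -∑ i, ∑ j, (z.2 i * z.2 j) •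
      christoffel cov x₀ (EuclideanSpace.single i 1) (EuclideanSpace.single j 1)
        ((extChartAt (𝓡 n) x₀).symm z.1) := by
    filter_upwards [(ht.preimage continuous_fst).mem_nhds hz] with y hy
    rw [spray, christoffel_sum cov (hmem _ hy)]
  refine ContDiffAt.congr_of_eventuallyEq ?_ heq
  refine ContDiffAt.neg (ContDiffAt.sum fun i _ => ContDiffAt.sum fun j _ => ContDiffAt.fun_smul ?_ ?_)
  · have hp : ∀ i, ContDiffAt ℝ ∞ (fun z : 𝔼 × 𝔼 => z.2 i) z := fun i =>
      ((EuclideanSpace.proj (𝕜 := ℝ) i : 𝔼 →L[ℝ] ℝ).contDiff.comp contDiff_snd).contDiffAt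
    exact (hp i).mul (hp j)
  · have h1 : ContDiffAt ℝ ∞ (fun y => christoffel cov x₀ (EuclideanSpace.single i 1)
        (EuclideanSpace.single j 1) ((extChartAt (𝓡 n) x₀).symm y)) z.1 := by
      rw [← contMDiffAt_iff_contDiffAt]
      exact (contMDiffAt_christoffel cov (hmem _ hz) _ _).comp z.1
        ((contMDiffOn_extChartAt_symm x₀).contMDiffAt (ht.mem_nhds hz))
    exact h1.comp z contDiffAt_fst

/-- The geodesic equation in the chart at `x₀` as a first order system. -/
def geodesicField (x₀ : M) (z : 𝔼 × 𝔼) : 𝔼 × 𝔼 := (z.2, spray cov x₀ z)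

lemma contDiffAt_geodesicField [CovariantDerivative.ContMDiffCovariantDerivative cov ∞] (x₀ : M)
    {z : 𝔼 × 𝔼} (hz : z.1 ∈ (extChartAt (𝓡 n) x₀).target) :
    ContDiffAt ℝ ∞ (geodesicField cov x₀) z :=
  contDiffAt_snd.prodMk (contDiffAt_spray cov x₀ hz)

end Spray

/-! ### Velocities in a chart -/

section Velocity

omit [IsManifold (𝓡 n) ∞ M] in
lemma hasDerivAt_extChartAt_comp [IsManifold (𝓡 n) ∞ M] {γ : ℝ → M} {t : ℝ}
    (hγ : MDifferentiableAt 𝓘(ℝ, ℝ) (𝓡 n) γ t)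
    {x₀ : M} (hx : γ t ∈ (chartAt 𝔼 x₀).source) :
    HasDerivAt (fun s => extChartAt (𝓡 n) x₀ (γ s)) (coordVec x₀ (γ t) (velocity γ t)) t := by
  have h1 : MDifferentiableAt (𝓡 n) 𝓘(ℝ, 𝔼) (extChartAt (𝓡 n) x₀) (γ t) :=
    mdifferentiableAt_extChartAt hx
  have h2 := h1.comp t hγ
  have h3 := (mdifferentiableAt_iff_differentiableAt.1 h2).hasDerivAt
  have h4 := mfderiv_comp t h1 hγ
  rw [mfderiv_eq_fderiv] at h4
  have h5 : coordVec x₀ (γ t) (velocity γ t) = deriv (extChartAt (𝓡 n) x₀ ∘ γ) t := by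
    rw [coordVec_eq hx, TangentBundle.continuousLinearMapAt_trivializationAt hx, velocity]
    exact congrArg (fun L => L (1 : ℝ)) h4.symm
  rw [h5]
  exact h3

/-- The lift of a curve to the tangent bundle. -/
def lift (γ : ℝ → M) (t : ℝ) : TangentBundle (𝓡 n) M := ⟨γ t, velocity γ t⟩

end Velocity

/-! ### Invariance of the geodesic equation under change of chart -/

section ChartChange

variable (cov : LinearConnection n M)

lemma velocity_eq_coordField {γ : ℝ → M} {t : ℝ} (hγ : MDifferentiableAt 𝓘(ℝ, ℝ) (𝓡 n) γ t)
    {x₀ : M} (hx : γ t ∈ (chartAt 𝔼 x₀).source) :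
    velocity γ t = coordField x₀ (deriv (fun s => extChartAt (𝓡 n) x₀ (γ s)) t) (γ t) := by
  rw [(hasDerivAt_extChartAt_comp hγ hx).deriv, coordField_coordVec hx]

/-- The left-hand side of the geodesic equation in the chart at `x₀`. -/
def acceleration (x₀ : M) (γ : ℝ → M) (t : ℝ) : 𝔼 :=
  deriv (deriv (fun s => extChartAt (𝓡 n) x₀ (γ s))) t +
    christoffel cov x₀ (deriv (fun s => extChartAt (𝓡 n) x₀ (γ s)) t)
      (deriv (fun s => extChartAt (𝓡 n) x₀ (γ s)) t) (γ t)

lemma acceleration_eq {γ : ℝ → M} {t : ℝ} (hγ : MDifferentiableAt 𝓘(ℝ, ℝ) (𝓡 n) γ t)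
    {x₀ : M} (hx : γ t ∈ (chartAt 𝔼 x₀).source) :
    deriv (deriv (fun s => extChartAt (𝓡 n) x₀ (γ s))) t +
      coordVec x₀ (γ t)
        (cov (coordField x₀ (deriv (fun s => extChartAt (𝓡 n) x₀ (γ s)) t)) (γ t)
          (velocity γ t)) = acceleration cov x₀ γ t := by
  rw [velocity_eq_coordField hγ hx]
  rfl

lemma contDiffAt_extChartAt_comp {γ : ℝ → M} {t : ℝ} (hγ : ContMDiffAt 𝓘(ℝ, ℝ) (𝓡 n) 2 γ t)
    {x₀ : M} (hx : γ t ∈ (chartAt 𝔼 x₀).source) :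
    ContDiffAt ℝ 2 (fun s => extChartAt (𝓡 n) x₀ (γ s)) t := by
  have h : ContMDiffAt (𝓡 n) 𝓘(ℝ, 𝔼) 2 (extChartAt (𝓡 n) x₀) (γ t) :=
    (contMDiffAt_extChartAt' (n := ∞) hx).of_le (WithTop.coe_le_coe.2 le_top)
  exact contMDiffAt_iff_contDiffAt.1 (h.comp t hγ)

lemma hasDerivAt_deriv_extChartAt_comp {γ : ℝ → M} {t : ℝ}
    (hγ : ContMDiffAt 𝓘(ℝ, ℝ) (𝓡 n) 2 γ t) {x₀ : M} (hx : γ t ∈ (chartAt 𝔼 x₀).source) :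
    HasDerivAt (deriv (fun s => extChartAt (𝓡 n) x₀ (γ s)))
      (deriv (deriv (fun s => extChartAt (𝓡 n) x₀ (γ s))) t) t := by
  have h := contDiffAt_extChartAt_comp hγ hx
  have h1 : ContDiffAt ℝ 1 (deriv (fun s => extChartAt (𝓡 n) x₀ (γ s))) t := by
    have h2 := h.fderiv_right (m := 1) (by norm_num)
    have h3 := h2.clm_apply (contDiffAt_const (c := (1 : ℝ)))
    exact h3
  exact (h1.differentiableAt one_ne_zero).hasDerivAt

/-- The geodesic equation is independent of the chart. -/
lemma acceleration_chart_change {γ : ℝ → M} {t : ℝ} (hγ : ContMDiffAt 𝓘(ℝ, ℝ) (𝓡 n) 2 γ t)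
    {x₀ x₁ : M} (h0 : γ t ∈ (chartAt 𝔼 x₀).source) (h1 : γ t ∈ (chartAt 𝔼 x₁).source) :
    acceleration cov x₀ γ t =
      coordVec x₀ (γ t) (coordField x₁ (acceleration cov x₁ γ t) (γ t)) := by
  set c0 := fun s => extChartAt (𝓡 n) x₀ (γ s) with hc0
  set c1 := fun s => extChartAt (𝓡 n) x₁ (γ s) with hc1
  let e0 := trivializationAt 𝔼 (fun x : M => TangentSpace (𝓡 n) x) x₀
  let e1 := trivializationAt 𝔼 (fun x : M => TangentSpace (𝓡 n) x) x₁
  let A : M → 𝔼 →L[ℝ] 𝔼 := fun y => (e1.coordChangeL ℝ e0 y : 𝔼 →L[ℝ] 𝔼)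
  have hA : ∀ y ∈ (chartAt 𝔼 x₀).source, y ∈ (chartAt 𝔼 x₁).source → ∀ w,
      A y w = coordVec x₀ y (coordField x₁ w y) := fun y hy0 hy1 w =>
    e1.coordChangeL_apply e0 ⟨mem_trivializationAt_baseSet hy1, mem_trivializationAt_baseSet hy0⟩ w
  have hmd : MDifferentiableAt 𝓘(ℝ, ℝ) (𝓡 n) γ t := hγ.mdifferentiableAt (by norm_num)
  have hAd : MDifferentiableAt (𝓡 n) 𝓘(ℝ, 𝔼 →L[ℝ] 𝔼) A (γ t) := by
    have : ContMDiffVectorBundle 1 𝔼 (fun x : M => TangentSpace (𝓡 n) x) (𝓡 n) :=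
      ContMDiffVectorBundle.of_le (n := ∞) (by exact_mod_cast le_top)
    exact (contMDiffAt_coordChangeL (n := 1) (mem_trivializationAt_baseSet h1)
      (mem_trivializationAt_baseSet h0)).mdifferentiableAt one_ne_zero
  have hAγ : HasDerivAt (fun s => A (γ s)) (deriv (fun s => A (γ s)) t) t :=
    (mdifferentiableAt_iff_differentiableAt.1 (hAd.comp t hmd)).hasDerivAt
  have hU0 : ∀ᶠ s in 𝓝 t, γ s ∈ (chartAt 𝔼 x₀).source :=
    hγ.continuousAt.eventually ((chartAt 𝔼 x₀).open_source.mem_nhds h0)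
  have hU1 : ∀ᶠ s in 𝓝 t, γ s ∈ (chartAt 𝔼 x₁).source :=
    hγ.continuousAt.eventually ((chartAt 𝔼 x₁).open_source.mem_nhds h1)
  have : IsManifold (𝓡 n) 2 M := IsManifold.of_le (n := ∞) (WithTop.coe_le_coe.2 le_top)
  have hγ2 : ∀ᶠ s in 𝓝 t, ContMDiffAt 𝓘(ℝ, ℝ) (𝓡 n) 2 γ s :=
    (contMDiffAt_iff_contMDiffAt_nhds (by decide)).1 hγ
  have hderiv : deriv c0 =ᶠ[𝓝 t] fun s => A (γ s) (deriv c1 s) := by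
    filter_upwards [hU0, hU1, hγ2] with s hs0 hs1 hs
    have hsd := hs.mdifferentiableAt (n := 2) (by norm_num)
    rw [hA _ hs0 hs1, ← velocity_eq_coordField hsd hs1, (hasDerivAt_extChartAt_comp hsd hs0).deriv]
  -- Differentiating `c0' = A c1'` produces the inhomogeneous term `A' c1'`. The same term, `hv`
  -- below, arises when the field with constant coordinates `c1'` in the chart at `x₁` is
  -- differentiated in the chart at `x₀`, so the covariant acceleration transforms like a vector.
  have hder2 : deriv (deriv c0) t =
      deriv (fun s => A (γ s)) t (deriv c1 t) + A (γ t) (deriv (deriv c1) t) := by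
    rw [hderiv.deriv_eq]
    exact (hAγ.clm_apply (hasDerivAt_deriv_extChartAt_comp hγ h1)).deriv
  have hcov := coordVec_cov cov h0 (mdifferentiableAt_coordField h1 (deriv c1 t)) (velocity γ t)
  have hv : mvfderiv (𝓡 n) (fun y => coordVec x₀ y (coordField x₁ (deriv c1 t) y)) (γ t)
      (velocity γ t) = deriv (fun s => A (γ s)) t (deriv c1 t) := by
    have hs := (mdifferentiableAt_section_iff_coordVec h0).1
      (mdifferentiableAt_coordField h1 (deriv c1 t))
    have h2 := mfderiv_comp t hs hmd
    rw [mfderiv_eq_fderiv] at h2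
    have h3 := congrArg (fun L => L (1 : ℝ)) h2
    refine Eq.trans h3.symm ?_
    change deriv (fun s => coordVec x₀ (γ s) (coordField x₁ (deriv c1 t) (γ s))) t = _
    have h4 : (fun s => coordVec x₀ (γ s) (coordField x₁ (deriv c1 t) (γ s))) =ᶠ[𝓝 t]
        fun s => A (γ s) (deriv c1 t) := by
      filter_upwards [hU0, hU1] with s hs0 hs1
      rw [hA _ hs0 hs1]
    rw [h4.deriv_eq]
    simpa using (hAγ.clm_apply (hasDerivAt_const t (deriv c1 t))).deriv
  rw [hv] at hcov
  rw [← hA _ h0 h1, hderiv.eq_of_nhds.symm] at hcov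
  rw [← acceleration_eq cov hmd h0, ← acceleration_eq cov hmd h1]
  rw [coordField_add h1, coordVec_add h0, coordField_coordVec h1, ← hA _ h0 h1]
  change deriv (deriv c0) t + coordVec x₀ (γ t)
      (cov (coordField x₀ (deriv c0 t)) (γ t) (velocity γ t)) =
    A (γ t) (deriv (deriv c1) t) + coordVec x₀ (γ t)
      (cov (coordField x₁ (deriv c1 t)) (γ t) (velocity γ t))
  rw [hcov, hder2]
  abel

end ChartChange

/-! ### The geodesic equation at a single time -/

section LocalGeodesic

variable {cov : LinearConnection n M}

lemma lift_congr {γ γ' : ℝ → M} {t : ℝ} (h : γ =ᶠ[𝓝 t] γ')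
    (hγ : MDifferentiableAt 𝓘(ℝ, ℝ) (𝓡 n) γ t) : lift (n := n) γ t = lift γ' t := by
  have hx : γ t ∈ (chartAt 𝔼 (γ t)).source := mem_chart_source _ _
  have hγ' : MDifferentiableAt 𝓘(ℝ, ℝ) (𝓡 n) γ' t := hγ.congr_of_eventuallyEq h.symm
  have h0 := h.eq_of_nhds
  have hx' : γ' t ∈ (chartAt 𝔼 (γ t)).source := h0 ▸ hx
  have hd : (fun s => extChartAt (𝓡 n) (γ t) (γ s)) =ᶠ[𝓝 t]
      fun s => extChartAt (𝓡 n) (γ t) (γ' s) := h.fun_comp _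
  rw [lift, lift, velocity_eq_coordField hγ hx, velocity_eq_coordField hγ' hx', hd.deriv_eq]
  exact congrArg (fun x => (⟨x, coordField (γ t) _ x⟩ : TangentBundle (𝓡 n) M)) h0

lemma acceleration_congr {γ γ' : ℝ → M} {t : ℝ} (h : γ =ᶠ[𝓝 t] γ') (x₀ : M) :
    acceleration cov x₀ γ t = acceleration cov x₀ γ' t := by
  have hd : (fun s => extChartAt (𝓡 n) x₀ (γ s)) =ᶠ[𝓝 t]
      fun s => extChartAt (𝓡 n) x₀ (γ' s) := h.fun_comp _
  rw [acceleration, acceleration, hd.deriv_eq, hd.deriv.deriv_eq, h.eq_of_nhds]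

variable (cov) in
/-- `γ` is a nonconstant solution of the geodesic equation at time `t`. -/
structure IsGeodesicAt (γ : ℝ → M) (t : ℝ) : Prop where
  contMDiffAt : ContMDiffAt 𝓘(ℝ, ℝ) (𝓡 n) 2 γ t
  lift_ne_zero : (lift (n := n) γ t).2 ≠ 0
  equation : ∃ x₀ : M, γ t ∈ (chartAt 𝔼 x₀).source ∧ acceleration cov x₀ γ t = 0

lemma IsGeodesicAt.mdifferentiableAt {γ : ℝ → M} {t : ℝ} (h : IsGeodesicAt cov γ t) :
    MDifferentiableAt 𝓘(ℝ, ℝ) (𝓡 n) γ t := h.contMDiffAt.mdifferentiableAt (by norm_num)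

lemma IsGeodesicAt.acceleration_eq_zero {γ : ℝ → M} {t : ℝ} (h : IsGeodesicAt cov γ t) {x₀ : M}
    (hx : γ t ∈ (chartAt 𝔼 x₀).source) : acceleration cov x₀ γ t = 0 := by
  obtain ⟨x₁, h1, h2⟩ := h.equation
  rw [acceleration_chart_change cov h.contMDiffAt hx h1, h2, coordField_eq h1, map_zero,
    coordVec_eq hx, map_zero]

lemma IsGeodesicAt.congr {γ γ' : ℝ → M} {t : ℝ} (h : IsGeodesicAt cov γ t) (he : γ =ᶠ[𝓝 t] γ') :
    IsGeodesicAt cov γ' t := by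
  refine ⟨h.contMDiffAt.congr_of_eventuallyEq he.symm, ?_, ?_⟩
  · rw [← lift_congr he h.mdifferentiableAt]
    exact h.lift_ne_zero
  · obtain ⟨x₀, h1, h2⟩ := h.equation
    exact ⟨x₀, he.eq_of_nhds ▸ h1, by rw [← acceleration_congr he, h2]⟩

/-- Being a geodesic is a condition on germs, and by invariance one chart per time suffices. Gluing,
restricting and reparametrising can then be done pointwise. -/
lemma isGeodesicOn_iff {γ : ℝ → M} {J : Set ℝ} : IsGeodesicOn cov γ J ↔
    IsOpen J ∧ J.OrdConnected ∧ J.Nonempty ∧ ∀ t ∈ J, IsGeodesicAt cov γ t := by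
  constructor
  · intro h
    refine ⟨h.isOpen, h.ordConnected, h.nonempty, fun t ht => ?_⟩
    have hc : ContMDiffAt 𝓘(ℝ, ℝ) (𝓡 n) 2 γ t :=
      h.contMDiffOn.contMDiffAt (h.isOpen.mem_nhds ht)
    refine ⟨hc, h.velocity_ne_zero t ht, γ t, mem_chart_source _ _, ?_⟩
    rw [← acceleration_eq cov (hc.mdifferentiableAt (by norm_num)) (mem_chart_source _ _)]
    exact h.equation t ht _ (mem_chart_source _ _)
  · rintro ⟨h1, h2, h3, h4⟩
    refine ⟨h1, h2, h3, fun t ht => (h4 t ht).contMDiffAt.contMDiffWithinAt,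
      fun t ht => (h4 t ht).lift_ne_zero, fun t ht x₀ hx => ?_⟩
    rw [acceleration_eq cov (h4 t ht).mdifferentiableAt hx]
    exact (h4 t ht).acceleration_eq_zero hx

end LocalGeodesic

/-! ### Local flows of ordinary differential equations -/

section Flow

/-- The local flow of a `C¹` vector field stays near its base point and is continuous in the
initial value. -/
lemma exists_continuousOn_local_flow {E : Type*} [NormedAddCommGroup E] [NormedSpace ℝ E]
    [CompleteSpace E] {f : E → E} {z₀ : E} (hf : ContDiffAt ℝ 1 f z₀) {W : Set E}
    (hW : W ∈ 𝓝 z₀) :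
    ∃ N ∈ 𝓝 z₀, ∃ ε > (0 : ℝ), ∃ α : E → ℝ → E,
      (∀ z ∈ N, α z 0 = z ∧ ∀ t ∈ Ioo (-ε) ε, α z t ∈ W ∧ HasDerivAt (α z) (f (α z t)) t) ∧
      ∀ t ∈ Ioo (-ε) ε, ContinuousOn (fun z => α z t) N := by
  obtain ⟨ε, hε, a, r, L, K, hr, hpl⟩ := IsPicardLindelof.of_contDiffAt_one hf
  obtain ⟨α, hα, hc⟩ := (hpl 0).exists_forall_mem_closedBall_eq_hasDerivWithinAt_continuousOn
  have h00 : ((z₀, 0) : E × ℝ) ∈ Metric.closedBall z₀ r ×ˢ Icc (0 - ε) (0 + ε) :=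
    ⟨Metric.mem_closedBall_self hr.le, by constructor <;> linarith⟩
  have hnhds : Metric.closedBall z₀ r ×ˢ Icc (0 - ε) (0 + ε) ∈ 𝓝 ((z₀, 0) : E × ℝ) :=
    prod_mem_nhds (Metric.closedBall_mem_nhds z₀ hr) (Icc_mem_nhds (by linarith) (by linarith))
  have hα0 : α (z₀, 0) = z₀ := (hα z₀ h00.1).1
  have hcont : ContinuousAt α (z₀, 0) := hc.continuousAt hnhds
  -- The flow is jointly continuous at `(z₀, 0)`, so it stays in `W` for nearby initial values and
  -- short times. The final time bound is the minimum of this one and the existence time.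
  have hW' : α ⁻¹' W ∈ 𝓝 ((z₀, 0) : E × ℝ) := hcont (by rwa [hα0])
  rw [nhds_prod_eq] at hW'
  obtain ⟨N₁, hN₁, T, hT, hNT⟩ := Filter.mem_prod_iff.1 hW'
  obtain ⟨δ, hδ, hδT⟩ := Metric.mem_nhds_iff.1 hT
  rw [Real.ball_eq_Ioo] at hδT
  have hsub : ∀ t ∈ Ioo (-min δ ε) (min δ ε), t ∈ Icc (0 - ε) (0 + ε) ∧ t ∈ T ∧
      Icc (0 - ε) (0 + ε) ∈ 𝓝 t := by
    intro t ht
    have h1 := min_le_left δ ε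
    have h2 := min_le_right δ ε
    refine ⟨⟨by linarith [ht.1], by linarith [ht.2]⟩,
      hδT ⟨by linarith [ht.1], by linarith [ht.2]⟩,
      Icc_mem_nhds (by linarith [ht.1]) (by linarith [ht.2])⟩
  refine ⟨N₁ ∩ Metric.closedBall z₀ r,
    Filter.inter_mem hN₁ (Metric.closedBall_mem_nhds z₀ hr), min δ ε, lt_min hδ hε,
    fun z t => α (z, t), fun z hz => ⟨(hα z hz.2).1, fun t ht => ?_⟩, fun t ht => ?_⟩
  · obtain ⟨h1, h2, h3⟩ := hsub t ht
    exact ⟨hNT ⟨hz.1, h2⟩, ((hα z hz.2).2 t h1).hasDerivAt h3⟩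
  · obtain ⟨h1, -, -⟩ := hsub t ht
    exact hc.comp (f := fun z => (z, t)) (by fun_prop) fun z hz => ⟨hz.2, h1⟩

/-- A solution of an autonomous `C²` differential equation is `C²`. -/
lemma contDiffAt_of_hasDerivAt {E : Type*} [NormedAddCommGroup E] [NormedSpace ℝ E]
    {f : E → E} {z : ℝ → E} {t : ℝ}
    (h : ∀ᶠ s in 𝓝 t, ContDiffAt ℝ 2 f (z s) ∧ HasDerivAt z (f (z s)) s) :
    ContDiffAt ℝ 2 z t := by
  obtain ⟨U, hU, hUo, htU⟩ := eventually_nhds_iff.1 h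
  have hd : DifferentiableOn ℝ z U := fun s hs =>
    (hU s hs).2.differentiableAt.differentiableWithinAt
  -- Bootstrapping: if `z` is `C^k` then so is its derivative `f ∘ z`, hence `z` is `C^(k+1)`. Two
  -- steps from continuity are enough.
  have step : ∀ k : ℕ, k ≤ 1 → ContDiffOn ℝ k z U → ContDiffOn ℝ (k + 1 : ℕ) z U := by
    intro k hk hz
    push_cast
    rw [contDiffOn_succ_iff_deriv_of_isOpen hUo]
    refine ⟨hd, by simp, ?_⟩
    have hk' : (k : WithTop ℕ∞) ≤ 2 := by
      exact_mod_cast (show k ≤ 2 by omega)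
    have : ContDiffOn ℝ k (f ∘ z) U := fun s hs =>
      ((hU s hs).1.of_le hk').comp_contDiffWithinAt s (hz s hs)
    exact this.congr fun s hs => (hU s hs).2.deriv
  have h0 : ContDiffOn ℝ (0 : ℕ) z U := by
    simpa using hd.continuousOn
  have h2 := step 1 le_rfl (step 0 (by simp) h0)
  exact_mod_cast h2.contDiffAt (hUo.mem_nhds htU)

end Flow

/-! ### Coordinates on the tangent bundle -/

section TangentCoordinates

/-- Coordinates on the tangent bundle given by the chart at `x₀`. -/
def toCoord (x₀ : M) (u : TangentBundle (𝓡 n) M) : 𝔼 × 𝔼 :=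
  (extChartAt (𝓡 n) x₀ u.1, coordVec x₀ u.1 u.2)

/-- The tangent vector with given coordinates in the chart at `x₀`. -/
def ofCoord (x₀ : M) (z : 𝔼 × 𝔼) : TangentBundle (𝓡 n) M :=
  ⟨(extChartAt (𝓡 n) x₀).symm z.1, coordField x₀ z.2 ((extChartAt (𝓡 n) x₀).symm z.1)⟩

omit [IsManifold (𝓡 n) ∞ M] in
lemma extChartAt_symm_mem {x₀ : M} {y : 𝔼} (hy : y ∈ (extChartAt (𝓡 n) x₀).target) :
    (extChartAt (𝓡 n) x₀).symm y ∈ (chartAt 𝔼 x₀).source := by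
  have := (extChartAt (𝓡 n) x₀).map_target hy
  rwa [extChartAt_source] at this

omit [IsManifold (𝓡 n) ∞ M] in
lemma extChartAt_mem_target {x₀ x : M} (hx : x ∈ (chartAt 𝔼 x₀).source) :
    extChartAt (𝓡 n) x₀ x ∈ (extChartAt (𝓡 n) x₀).target :=
  (extChartAt (𝓡 n) x₀).map_source (by rwa [extChartAt_source])

omit [IsManifold (𝓡 n) ∞ M] in
lemma extChartAt_symm_apply {x₀ x : M} (hx : x ∈ (chartAt 𝔼 x₀).source) :
    (extChartAt (𝓡 n) x₀).symm (extChartAt (𝓡 n) x₀ x) = x :=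
  (extChartAt (𝓡 n) x₀).left_inv (by rwa [extChartAt_source])

lemma ofCoord_toCoord {x₀ : M} {u : TangentBundle (𝓡 n) M} (hu : u.1 ∈ (chartAt 𝔼 x₀).source) :
    ofCoord x₀ (toCoord x₀ u) = u := by
  obtain ⟨x, v⟩ := u
  simp only [ofCoord, toCoord]
  rw [extChartAt_symm_apply hu, coordField_coordVec hu]

lemma continuousAt_toCoord {x₀ : M} {u : TangentBundle (𝓡 n) M}
    (hu : u.1 ∈ (chartAt 𝔼 x₀).source) : ContinuousAt (toCoord x₀) u := by
  let e := trivializationAt 𝔼 (fun x : M => TangentSpace (𝓡 n) x) x₀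
  have he : ContinuousAt e u := e.continuousOn.continuousAt
    (e.open_source.mem_nhds (e.mem_source.2 (mem_trivializationAt_baseSet hu)))
  have hp : ContinuousAt (fun u : TangentBundle (𝓡 n) M => u.1) u :=
    (FiberBundle.continuous_proj 𝔼 (fun x : M => TangentSpace (𝓡 n) x)).continuousAt
  exact ((continuousAt_extChartAt' (by rwa [extChartAt_source])).comp hp).prodMk
    (continuous_snd.continuousAt.comp he)

lemma continuousAt_ofCoord {x₀ : M} {z : 𝔼 × 𝔼} (hz : z.1 ∈ (extChartAt (𝓡 n) x₀).target) :
    ContinuousAt (ofCoord x₀) z := by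
  let e := trivializationAt 𝔼 (fun x : M => TangentSpace (𝓡 n) x) x₀
  have h1 : ContinuousAt (fun z : 𝔼 × 𝔼 => ((extChartAt (𝓡 n) x₀).symm z.1, z.2)) z :=
    ((continuousOn_extChartAt_symm x₀).continuousAt
      ((isOpen_extChartAt_target x₀).mem_nhds hz) |>.comp continuousAt_fst).prodMk continuousAt_snd
  have h2 : ContinuousAt e.toOpenPartialHomeomorph.symm ((extChartAt (𝓡 n) x₀).symm z.1, z.2) :=
    e.toOpenPartialHomeomorph.symm.continuousOn.continuousAt (e.open_target.mem_nhds
      (e.mem_target.2 (mem_trivializationAt_baseSet (extChartAt_symm_mem hz))))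
  refine (h2.comp (f := fun z : 𝔼 × 𝔼 => ((extChartAt (𝓡 n) x₀).symm z.1, z.2)) h1).congr ?_
  filter_upwards [((isOpen_extChartAt_target (I := 𝓡 n) x₀).preimage continuous_fst).mem_nhds hz]
    with y hy
  exact (e.mk_symm (mem_trivializationAt_baseSet (extChartAt_symm_mem hy)) _).symm

lemma ofCoord_snd_ne_zero {x₀ : M} {z : 𝔼 × 𝔼} (hz : z.1 ∈ (extChartAt (𝓡 n) x₀).target) :
    (ofCoord x₀ z).2 ≠ 0 ↔ z.2 ≠ 0 := by
  have h := coordVec_eq_zero_iff (x₀ := x₀) (extChartAt_symm_mem hz) (ofCoord x₀ z).2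
  refine not_congr (h.symm.trans ?_)
  rw [ofCoord, coordVec_coordField (extChartAt_symm_mem hz)]

end TangentCoordinates

/-! ### Geodesics as integral curves of the spray -/

section IntegralCurves

variable {cov : LinearConnection n M}

lemma toCoord_lift {γ : ℝ → M} {t : ℝ} (hγ : MDifferentiableAt 𝓘(ℝ, ℝ) (𝓡 n) γ t)
    {x₀ : M} (hx : γ t ∈ (chartAt 𝔼 x₀).source) :
    toCoord x₀ (lift γ t) =
      (extChartAt (𝓡 n) x₀ (γ t), deriv (fun s => extChartAt (𝓡 n) x₀ (γ s)) t) :=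
  Prod.ext rfl (hasDerivAt_extChartAt_comp hγ hx).deriv.symm

lemma IsGeodesicAt.hasDerivAt_toCoord {γ : ℝ → M} {t : ℝ} {x₀ : M} (h : IsGeodesicAt cov γ t)
    (hx : γ t ∈ (chartAt 𝔼 x₀).source) :
    HasDerivAt (fun s => toCoord x₀ (lift γ s))
      (geodesicField cov x₀ (toCoord x₀ (lift γ t))) t := by
  have : IsManifold (𝓡 n) 2 M := IsManifold.of_le (n := ∞) (WithTop.coe_le_coe.2 le_top)
  have heq : (fun s => toCoord x₀ (lift γ s)) =ᶠ[𝓝 t] fun s =>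
      (extChartAt (𝓡 n) x₀ (γ s), deriv (fun s => extChartAt (𝓡 n) x₀ (γ s)) s) := by
    filter_upwards [h.contMDiffAt.continuousAt.eventually
      ((chartAt 𝔼 x₀).open_source.mem_nhds hx),
      (contMDiffAt_iff_contMDiffAt_nhds (by decide)).1 h.contMDiffAt] with s hs hs'
    exact toCoord_lift (hs'.mdifferentiableAt (by norm_num)) hs
  rw [heq.hasDerivAt_iff, toCoord_lift h.mdifferentiableAt hx]
  have h1 := hasDerivAt_extChartAt_comp h.mdifferentiableAt hx
  have h2 := hasDerivAt_deriv_extChartAt_comp h.contMDiffAt hx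
  have h3 := h.acceleration_eq_zero hx
  rw [← h1.deriv] at h1
  have h4 := h1.prodMk h2
  rw [acceleration, ← eq_neg_iff_add_eq_zero] at h3
  rw [h3] at h4
  simpa only [geodesicField, spray, extChartAt_symm_apply hx] using h4

/-- The first component of the system says that `z.2` is the derivative of `z.1`, so the second one
is the geodesic equation for `z.1`. Smoothness of the field upgrades the differentiable solution to
a `C²` one. -/
lemma isGeodesicAt_of_hasDerivAt [T2Space M]
    [CovariantDerivative.ContMDiffCovariantDerivative cov ∞] {z : ℝ → 𝔼 × 𝔼} {t : ℝ} {x₀ : M}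
    (h : ∀ᶠ s in 𝓝 t, (z s).1 ∈ (extChartAt (𝓡 n) x₀).target ∧
      HasDerivAt z (geodesicField cov x₀ (z s)) s) (hz : (z t).2 ≠ 0) :
    IsGeodesicAt cov (fun s => (extChartAt (𝓡 n) x₀).symm (z s).1) t ∧
      lift (fun s => (extChartAt (𝓡 n) x₀).symm (z s).1) t = ofCoord x₀ (z t) := by
  set γ : ℝ → M := fun s => (extChartAt (𝓡 n) x₀).symm (z s).1 with hγ
  have ht := h.self_of_nhds
  have hsrc : γ t ∈ (chartAt 𝔼 x₀).source := extChartAt_symm_mem ht.1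
  have hz2 : ContDiffAt ℝ 2 z t := contDiffAt_of_hasDerivAt (by
    filter_upwards [h] with s hs
    exact ⟨(contDiffAt_geodesicField cov x₀ hs.1).of_le (WithTop.coe_le_coe.2 le_top), hs.2⟩)
  have hc : ContMDiffAt 𝓘(ℝ, ℝ) (𝓡 n) 2 γ t := by
    have h1 : ContMDiffAt 𝓘(ℝ, 𝔼) (𝓡 n) 2 (extChartAt (𝓡 n) x₀).symm (z t).1 :=
      ((contMDiffOn_extChartAt_symm (n := ∞) x₀).contMDiffAt
        ((isOpen_extChartAt_target x₀).mem_nhds ht.1)).of_le (WithTop.coe_le_coe.2 le_top)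
    exact h1.comp t (contMDiffAt_iff_contDiffAt.2 hz2.fst)
  have hmd : MDifferentiableAt 𝓘(ℝ, ℝ) (𝓡 n) γ t := hc.mdifferentiableAt (by norm_num)
  have hc1 : (fun s => extChartAt (𝓡 n) x₀ (γ s)) =ᶠ[𝓝 t] fun s => (z s).1 := by
    filter_upwards [h] with s hs
    exact (extChartAt (𝓡 n) x₀).right_inv hs.1
  have hc2 : deriv (fun s => extChartAt (𝓡 n) x₀ (γ s)) =ᶠ[𝓝 t] fun s => (z s).2 := by
    refine hc1.deriv.trans ?_
    filter_upwards [h] with s hs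
    exact (hasFDerivAt_fst.comp_hasDerivAt s hs.2).deriv
  have hlift : lift γ t = ofCoord x₀ (z t) := by
    rw [lift, velocity_eq_coordField hmd hsrc, hc2.eq_of_nhds]
    rfl
  refine ⟨⟨hc, ?_, x₀, hsrc, ?_⟩, hlift⟩
  · rw [hlift, ofCoord_snd_ne_zero ht.1]
    exact hz
  · rw [acceleration, hc2.deriv_eq, hc2.eq_of_nhds, 
      (show deriv (fun s => (z s).2) t = _ from (hasFDerivAt_snd.comp_hasDerivAt t ht.2).deriv)]
    exact neg_add_cancel _

end IntegralCurves

/-! ### Local existence, uniqueness and continuous dependence of geodesics -/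

section LocalTheory

variable {cov : LinearConnection n M} [T2Space M]
  [CovariantDerivative.ContMDiffCovariantDerivative cov ∞]

variable (cov) in
/-- Existence of geodesics with given initial velocity, and their continuous dependence on it. -/
lemma exists_local_geodesic_flow (u₀ : TangentBundle (𝓡 n) M) (hu₀ : u₀.2 ≠ 0) :
    ∃ N ∈ 𝓝 u₀, ∃ ε > (0 : ℝ), ∃ c : TangentBundle (𝓡 n) M → ℝ → M,
      (∀ u ∈ N, lift (c u) 0 = u ∧ ∀ t ∈ Ioo (-ε) ε, IsGeodesicAt cov (c u) t) ∧
      ∀ t ∈ Ioo (-ε) ε, ContinuousOn (fun u => lift (n := n) (c u) t) N := by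
  set x₀ := u₀.1 with hx₀
  have hsrc : u₀.1 ∈ (chartAt 𝔼 x₀).source := mem_chart_source _ _
  have ht0 : (toCoord x₀ u₀).1 ∈ (extChartAt (𝓡 n) x₀).target := extChartAt_mem_target hsrc
  have hz0 : (toCoord x₀ u₀).2 ≠ 0 := by
    rwa [← ofCoord_snd_ne_zero ht0, ofCoord_toCoord hsrc]
  -- The flow has to remain in the chart with nonzero velocity for its trajectories to be geodesics
  -- in the present sense.
  have hW : {z : 𝔼 × 𝔼 | z.1 ∈ (extChartAt (𝓡 n) x₀).target ∧ z.2 ≠ 0} ∈ 𝓝 (toCoord x₀ u₀) :=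
    Filter.inter_mem (((isOpen_extChartAt_target x₀).preimage continuous_fst).mem_nhds ht0)
      ((isOpen_compl_singleton.preimage continuous_snd).mem_nhds hz0)
  obtain ⟨N, hN, ε, hε, α, hα, hαc⟩ := exists_continuousOn_local_flow
    ((contDiffAt_geodesicField cov x₀ ht0).of_le (by simp : (1 : WithTop ℕ∞) ≤ ∞)) hW
  have hproj : Continuous (fun u : TangentBundle (𝓡 n) M => u.1) :=
    FiberBundle.continuous_proj 𝔼 (fun x : M => TangentSpace (𝓡 n) x)
  have h0 : (0 : ℝ) ∈ Ioo (-ε) ε := ⟨by linarith, hε⟩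
  let N' : Set (TangentBundle (𝓡 n) M) :=
    (fun u => u.1) ⁻¹' (chartAt 𝔼 x₀).source ∩ toCoord x₀ ⁻¹' N
  have key : ∀ u ∈ N', ∀ t ∈ Ioo (-ε) ε,
      IsGeodesicAt cov (fun s => (extChartAt (𝓡 n) x₀).symm (α (toCoord x₀ u) s).1) t ∧
      lift (fun s => (extChartAt (𝓡 n) x₀).symm (α (toCoord x₀ u) s).1) t =
        ofCoord x₀ (α (toCoord x₀ u) t) := by
    intro u hu t ht
    refine isGeodesicAt_of_hasDerivAt ?_ ((hα _ hu.2).2 t ht).1.2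
    filter_upwards [isOpen_Ioo.mem_nhds ht] with s hs
    exact ⟨((hα _ hu.2).2 s hs).1.1, ((hα _ hu.2).2 s hs).2⟩
  refine ⟨N', Filter.inter_mem (((chartAt 𝔼 x₀).open_source.preimage hproj).mem_nhds hsrc)
    (continuousAt_toCoord hsrc hN), ε, hε,
    fun u s => (extChartAt (𝓡 n) x₀).symm (α (toCoord x₀ u) s).1,
    fun u hu => ⟨?_, fun t ht => (key u hu t ht).1⟩, fun t ht => ?_⟩
  · rw [(key u hu 0 h0).2, (hα _ hu.2).1, ofCoord_toCoord hu.1]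
  · have h1 : ContinuousOn (fun u => ofCoord x₀ (α (toCoord x₀ u) t)) N' := by
      intro u hu
      have h2 : ContinuousWithinAt (fun u => α (toCoord x₀ u) t) N' u :=
        ContinuousWithinAt.comp (g := fun z => α z t) (hαc t ht _ hu.2)
          (continuousAt_toCoord hu.1).continuousWithinAt fun v hv => hv.2
      exact ContinuousAt.comp_continuousWithinAt (f := fun u => α (toCoord x₀ u) t)
        (continuousAt_ofCoord ((hα _ hu.2).2 t ht).1.1) h2
    exact h1.congr fun u hu => (key u hu t ht).2

omit [T2Space M] [CovariantDerivative.ContMDiffCovariantDerivative cov ∞] in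
lemma IsGeodesicAt.continuousAt_lift {γ : ℝ → M} {t : ℝ} (h : ∀ᶠ s in 𝓝 t, IsGeodesicAt cov γ s) :
    ContinuousAt (lift (n := n) γ) t := by
  set x₀ := γ t
  have ht := h.self_of_nhds
  have hx : γ t ∈ (chartAt 𝔼 x₀).source := mem_chart_source _ _
  have h1 := (ht.hasDerivAt_toCoord hx).continuousAt
  have h2 := (continuousAt_ofCoord (x₀ := x₀) (z := toCoord x₀ (lift γ t))
    (extChartAt_mem_target hx)).comp (f := fun s => toCoord x₀ (lift γ s)) h1
  refine h2.congr ?_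
  filter_upwards [ht.contMDiffAt.continuousAt.eventually
    ((chartAt 𝔼 x₀).open_source.mem_nhds hx)] with s hs
  exact ofCoord_toCoord (u := lift γ s) hs

/-- Local uniqueness of geodesics. -/
lemma eventuallyEq_of_lift_eq {γ₁ γ₂ : ℝ → M} {t : ℝ} (h₁ : ∀ᶠ s in 𝓝 t, IsGeodesicAt cov γ₁ s)
    (h₂ : ∀ᶠ s in 𝓝 t, IsGeodesicAt cov γ₂ s) (h : lift (n := n) γ₁ t = lift γ₂ t) :
    γ₁ =ᶠ[𝓝 t] γ₂ := by
  set x₀ := γ₁ t with hx₀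
  have hx1 : γ₁ t ∈ (chartAt 𝔼 x₀).source := mem_chart_source _ _
  have h0 : γ₁ t = γ₂ t := congrArg (fun u : TangentBundle (𝓡 n) M => u.1) h
  have hx2 : γ₂ t ∈ (chartAt 𝔼 x₀).source := h0 ▸ hx1
  have ht1 := h₁.self_of_nhds
  have ht2 := h₂.self_of_nhds
  obtain ⟨K, s, hs, hl⟩ := ((contDiffAt_geodesicField cov x₀ (z := toCoord x₀ (lift γ₁ t))
    (extChartAt_mem_target hx1)).of_le (by simp : (1 : WithTop ℕ∞) ≤ ∞)).exists_lipschitzOnWith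
  have hU1 := ht1.contMDiffAt.continuousAt.eventually
    ((chartAt 𝔼 x₀).open_source.mem_nhds hx1)
  have hU2 := ht2.contMDiffAt.continuousAt.eventually
    ((chartAt 𝔼 x₀).open_source.mem_nhds hx2)
  have hs1 := (ht1.hasDerivAt_toCoord hx1).continuousAt.eventually hs
  have hs' : s ∈ 𝓝 (toCoord x₀ (lift γ₂ t)) := by rwa [← h]
  have hs2 := (ht2.hasDerivAt_toCoord hx2).continuousAt.eventually hs'
  have hode := ODE_solution_unique_of_eventually (v := fun _ => geodesicField cov x₀)
    (s := fun _ => s) (t₀ := t) (f := fun s => toCoord x₀ (lift γ₁ s))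
    (g := fun s => toCoord x₀ (lift γ₂ s)) (Filter.Eventually.of_forall fun _ => hl)
    (by filter_upwards [h₁, hU1, hs1] with r hr hr1 hr2 using ⟨hr.hasDerivAt_toCoord hr1, hr2⟩)
    (by filter_upwards [h₂, hU2, hs2] with r hr hr1 hr2 using ⟨hr.hasDerivAt_toCoord hr1, hr2⟩)
    (by rw [h])
  filter_upwards [hode, hU1, hU2] with r hr hr1 hr2
  rw [← extChartAt_symm_apply hr1, ← extChartAt_symm_apply hr2]
  exact congrArg (fun z => (extChartAt (𝓡 n) x₀).symm z.1) hr

/-- Uniqueness of geodesics. -/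
lemma lift_eqOn_of_lift_eq {γ₁ γ₂ : ℝ → M} {J : Set ℝ} (hJ : IsOpen J) (hJc : J.OrdConnected)
    (h₁ : ∀ s ∈ J, IsGeodesicAt cov γ₁ s) (h₂ : ∀ s ∈ J, IsGeodesicAt cov γ₂ s) {t : ℝ}
    (ht : t ∈ J) (h : lift (n := n) γ₁ t = lift γ₂ t) :
    EqOn (lift (n := n) γ₁) (lift γ₂) J := by
  have e₁ : ∀ s ∈ J, ∀ᶠ r in 𝓝 s, IsGeodesicAt cov γ₁ r := fun s hs => by
    filter_upwards [hJ.mem_nhds hs] with r hr using h₁ r hr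
  have e₂ : ∀ s ∈ J, ∀ᶠ r in 𝓝 s, IsGeodesicAt cov γ₂ r := fun s hs => by
    filter_upwards [hJ.mem_nhds hs] with r hr using h₂ r hr
  let u : Set ℝ := {s | γ₁ =ᶠ[𝓝 s] γ₂}
  have hu : IsOpen u := isOpen_iff_mem_nhds.2 fun s hs => hs.eventuallyEq_nhds
  have hsub : J ⊆ u := by
    refine hJc.isPreconnected.subset_of_closure_inter_subset hu
      ⟨t, ht, eventuallyEq_of_lift_eq (e₁ t ht) (e₂ t ht) h⟩ ?_
    -- The set where the germs agree is also closed in `J`: positions agree in the limit because `M`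
    -- is Hausdorff, velocities agree after passing to coordinates, and local uniqueness applies
    -- again.
    rintro s ⟨hs, hsJ⟩
    have hfreq : ∃ᶠ r in 𝓝 s, r ∈ u := mem_closure_iff_frequently.1 hs
    have h0 : γ₁ s = γ₂ s := tendsto_nhds_unique_of_frequently_eq
      (h₁ s hsJ).contMDiffAt.continuousAt (h₂ s hsJ).contMDiffAt.continuousAt
      (hfreq.mono fun r hr => hr.eq_of_nhds)
    have hx1 : γ₁ s ∈ (chartAt 𝔼 (γ₁ s)).source := mem_chart_source _ _
    have hx2 : γ₂ s ∈ (chartAt 𝔼 (γ₁ s)).source := h0 ▸ hx1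
    have hz : toCoord (γ₁ s) (lift γ₁ s) = toCoord (γ₁ s) (lift γ₂ s) :=
      tendsto_nhds_unique_of_frequently_eq
        ((h₁ s hsJ).hasDerivAt_toCoord hx1).continuousAt
        ((h₂ s hsJ).hasDerivAt_toCoord hx2).continuousAt
        ((hfreq.and_eventually (e₁ s hsJ)).mono fun r hr => by
          rw [lift_congr hr.1 hr.2.mdifferentiableAt])
    refine eventuallyEq_of_lift_eq (e₁ s hsJ) (e₂ s hsJ) ?_
    rw [← ofCoord_toCoord (u := lift γ₁ s) hx1, hz, ofCoord_toCoord (u := lift γ₂ s) hx2]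
  exact fun s hs => lift_congr (hsub hs) (h₁ s hs).mdifferentiableAt

end LocalTheory

/-! ### Affine reparametrisation -/

section Affine

variable {cov : LinearConnection n M}

/-- Multiplication of a tangent vector by a scalar. -/
def scale (c : ℝ) (u : TangentBundle (𝓡 n) M) : TangentBundle (𝓡 n) M := ⟨u.1, c • u.2⟩

lemma scale_scale (c d : ℝ) (u : TangentBundle (𝓡 n) M) :
    scale c (scale d u) = scale (c * d) u :=
  congrArg (TotalSpace.mk u.1) (smul_smul c d u.2)

omit [IsManifold (𝓡 n) ∞ M] in
lemma scale_one (u : TangentBundle (𝓡 n) M) : scale 1 u = u := by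
  simp [scale]

lemma scale_inv_scale {c : ℝ} (hc : c ≠ 0) (u : TangentBundle (𝓡 n) M) :
    scale c⁻¹ (scale c u) = u := by
  rw [scale_scale, inv_mul_cancel₀ hc, scale_one]

lemma scale_snd_ne_zero {c : ℝ} (hc : c ≠ 0) {u : TangentBundle (𝓡 n) M} :
    (scale c u).2 ≠ 0 ↔ u.2 ≠ 0 :=
  not_congr (smul_eq_zero_iff_right (R := ℝ) (M := TangentSpace (𝓡 n) u.1) hc)

lemma continuous_scale (c : ℝ) : Continuous (scale (n := n) (M := M) c) := by
  refine continuous_iff_continuousAt.2 fun u => ?_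
  have hx : u.1 ∈ (chartAt 𝔼 u.1).source := mem_chart_source _ _
  have hproj : Continuous (fun u : TangentBundle (𝓡 n) M => u.1) :=
    FiberBundle.continuous_proj 𝔼 (fun x : M => TangentSpace (𝓡 n) x)
  have h1 : ContinuousAt (fun w => ((toCoord u.1 w).1, c • (toCoord u.1 w).2)) u :=
    (continuousAt_fst.comp (continuousAt_toCoord hx)).prodMk
      ((continuousAt_snd.comp (continuousAt_toCoord hx)).const_smul c)
  have h2 := (continuousAt_ofCoord (x₀ := u.1) (z := ((toCoord u.1 u).1, c • (toCoord u.1 u).2))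
    (extChartAt_mem_target hx)).comp
      (f := fun w => ((toCoord u.1 w).1, c • (toCoord u.1 w).2)) h1
  refine h2.congr ?_
  filter_upwards [((chartAt 𝔼 u.1).open_source.preimage hproj).mem_nhds hx] with w hw
  have h3 : ((toCoord u.1 w).1, c • (toCoord u.1 w).2) = toCoord u.1 (scale c w) :=
    Prod.ext rfl (coordVec_smul hw c w.2).symm
  rw [Function.comp_apply, h3, ofCoord_toCoord]
  exact hw

lemma christoffel_smul_smul {x₀ x : M} (hx : x ∈ (chartAt 𝔼 x₀).source) (a : ℝ) (v w : 𝔼) :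
    christoffel cov x₀ (a • v) (a • w) x = (a * a) • christoffel cov x₀ v w x := by
  rw [christoffel_sum cov hx, christoffel_sum cov hx v w]
  simp only [Finset.smul_sum, smul_smul, PiLp.smul_apply, smul_eq_mul]
  refine Finset.sum_congr rfl fun i _ => Finset.sum_congr rfl fun j _ => ?_
  congr 1
  ring

lemma deriv_comp_affine {E : Type*} [NormedAddCommGroup E] [NormedSpace ℝ E] (f : ℝ → E)
    (a b t : ℝ) : deriv (fun s => f (a * s + b)) t = a • deriv f (a * t + b) := by
  have h := deriv_comp_mul_left a (fun y => f (y + b)) t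
  rw [deriv_comp_add_const] at h
  exact h

/-- Affine reparametrisations of geodesics are geodesics. -/
lemma IsGeodesicAt.comp_affine {γ : ℝ → M} {a b t : ℝ} (ha : a ≠ 0)
    (h : IsGeodesicAt cov γ (a * t + b)) :
    IsGeodesicAt cov (fun s => γ (a * s + b)) t ∧
      lift (fun s => γ (a * s + b)) t = scale a (lift (n := n) γ (a * t + b)) := by
  set x₀ := γ (a * t + b) with hx₀
  have hx : γ (a * t + b) ∈ (chartAt 𝔼 x₀).source := mem_chart_source _ _
  have haff : ContMDiff 𝓘(ℝ, ℝ) 𝓘(ℝ, ℝ) 2 (fun s : ℝ => a * s + b) := by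
    rw [contMDiff_iff_contDiff]
    fun_prop
  have hc : ContMDiffAt 𝓘(ℝ, ℝ) (𝓡 n) 2 (fun s => γ (a * s + b)) t :=
    h.contMDiffAt.comp t (haff t)
  have hmd : MDifferentiableAt 𝓘(ℝ, ℝ) (𝓡 n) (fun s => γ (a * s + b)) t :=
    hc.mdifferentiableAt (by norm_num)
  have hd := deriv_comp_affine (fun s => extChartAt (𝓡 n) x₀ (γ s)) a b
  have hlift : lift (fun s => γ (a * s + b)) t = scale a (lift (n := n) γ (a * t + b)) := by
    rw [lift, scale, lift, velocity_eq_coordField hmd (x₀ := x₀) hx, hd, coordField_smul hx,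
      ← velocity_eq_coordField h.mdifferentiableAt hx]
  refine ⟨⟨hc, ?_, x₀, hx, ?_⟩, hlift⟩
  · rw [hlift, scale_snd_ne_zero ha]
    exact h.lift_ne_zero
  · have hz := h.acceleration_eq_zero hx
    rw [acceleration] at hz ⊢
    rw [funext hd, christoffel_smul_smul hx,
      deriv_fun_const_smul_field a, deriv_comp_affine (deriv fun s => extChartAt (𝓡 n) x₀ (γ s)),
      smul_smul, ← smul_add, hz, smul_zero]

end Affine

/-! ### Inextendible geodesics -/

section Maximal

variable {cov : LinearConnection n M}

lemma IsGeodesicOn.isGeodesicAt {γ : ℝ → M} {J : Set ℝ} (h : IsGeodesicOn cov γ J) {t : ℝ}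
    (ht : t ∈ J) : IsGeodesicAt cov γ t := (isGeodesicOn_iff.1 h).2.2.2 t ht

lemma IsGeodesicOn.eventually_isGeodesicAt {γ : ℝ → M} {J : Set ℝ} (h : IsGeodesicOn cov γ J)
    {t : ℝ} (ht : t ∈ J) : ∀ᶠ s in 𝓝 t, IsGeodesicAt cov γ s := by
  filter_upwards [h.isOpen.mem_nhds ht] with s hs using h.isGeodesicAt hs

lemma IsGeodesicOn.comp_affine {γ : ℝ → M} {J : Set ℝ} (h : IsGeodesicOn cov γ J) {a : ℝ}
    (ha : a ≠ 0) (b : ℝ) :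
    IsGeodesicOn cov (fun s => γ (a * s + b)) ((fun s => a * s + b) ⁻¹' J) := by
  have hsurj : ∀ y : ℝ, a * (a⁻¹ * (y - b)) + b = y := fun y => by field_simp; ring
  refine isGeodesicOn_iff.2 ⟨h.isOpen.preimage (by fun_prop), ⟨?_⟩, ?_, fun t ht =>
    (IsGeodesicAt.comp_affine ha (h.isGeodesicAt ht)).1⟩
  · intro x hx y hy z hz
    rcases lt_or_gt_of_ne ha with ha | ha
    · exact h.ordConnected.out hy hx ⟨by nlinarith [hz.2], by nlinarith [hz.1]⟩
    · exact h.ordConnected.out hx hy ⟨by nlinarith [hz.1], by nlinarith [hz.2]⟩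
  · obtain ⟨y, hy⟩ := h.nonempty
    exact ⟨a⁻¹ * (y - b), by rwa [mem_preimage, hsurj]⟩

lemma IsGeodesic.comp_affine {γ : ℝ → M} {J : Set ℝ} (h : IsGeodesic cov γ J) {a : ℝ}
    (ha : a ≠ 0) (b : ℝ) :
    IsGeodesic cov (fun s => γ (a * s + b)) ((fun s => a * s + b) ⁻¹' J) := by
  refine ⟨h.1.comp_affine ha b, fun γ' J' h' hsub heq => ?_⟩
  have hsurj : ∀ y : ℝ, a * (a⁻¹ * y + -(a⁻¹ * b)) + b = y := fun y => by field_simp; ring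
  have hinj : ∀ y : ℝ, a⁻¹ * (a * y + b) + -(a⁻¹ * b) = y := fun y => by field_simp; ring
  -- Any extension of the reparametrised curve is carried back by the inverse affine map to an
  -- extension of `γ`, which must be trivial.
  have h2 := h.2 _ _ (h'.comp_affine (inv_ne_zero ha) (-(a⁻¹ * b))) (fun y hy => hsub (by
    rwa [mem_preimage, hsurj])) (fun y hy => by
      have := heq (x := a⁻¹ * y + -(a⁻¹ * b)) (by rwa [mem_preimage, hsurj])
      exact this.trans (congrArg γ (hsurj y)))
  ext y
  rw [mem_preimage, ← h2, mem_preimage, hinj]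

variable [T2Space M] [CovariantDerivative.ContMDiffCovariantDerivative cov ∞]

lemma IsGeodesicOn.lift_eqOn_inter {γ₁ γ₂ : ℝ → M} {J₁ J₂ : Set ℝ} (h₁ : IsGeodesicOn cov γ₁ J₁)
    (h₂ : IsGeodesicOn cov γ₂ J₂) {t : ℝ} (ht₁ : t ∈ J₁) (ht₂ : t ∈ J₂)
    (h : lift (n := n) γ₁ t = lift γ₂ t) : EqOn (lift (n := n) γ₁) (lift γ₂) (J₁ ∩ J₂) :=
  lift_eqOn_of_lift_eq (h₁.isOpen.inter h₂.isOpen) (h₁.ordConnected.inter h₂.ordConnected)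
    (fun _ hs => h₁.isGeodesicAt hs.1) (fun _ hs => h₂.isGeodesicAt hs.2) ⟨ht₁, ht₂⟩ h

omit [T2Space M] [CovariantDerivative.ContMDiffCovariantDerivative cov ∞] in
lemma IsGeodesicOn.lift_eq_of_eqOn {γ₁ γ₂ : ℝ → M} {J : Set ℝ} (h₁ : IsGeodesicOn cov γ₁ J)
    (h : EqOn γ₂ γ₁ J) {t : ℝ} (ht : t ∈ J) : lift (n := n) γ₂ t = lift γ₁ t := by
  refine (lift_congr ?_ (h₁.isGeodesicAt ht).mdifferentiableAt).symm
  filter_upwards [h₁.isOpen.mem_nhds ht] with s hs using (h hs).symm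

/-- A geodesic extends to a largest one among those with the same velocity at a given time. -/
lemma exists_largest_geodesic {γ₀ : ℝ → M} {J₀ : Set ℝ} (h₀ : IsGeodesicOn cov γ₀ J₀) {t₀ : ℝ}
    (ht₀ : t₀ ∈ J₀) :
    ∃ (γ : ℝ → M) (J : Set ℝ), IsGeodesicOn cov γ J ∧
      ∀ (γ' : ℝ → M) (J' : Set ℝ), IsGeodesicOn cov γ' J' → t₀ ∈ J' →
        lift (n := n) γ' t₀ = lift γ₀ t₀ → J' ⊆ J ∧ EqOn γ γ' J' := by
  classical
  -- The largest geodesic is the union of all geodesics with the given velocity at `t₀`. By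
  -- uniqueness they agree on overlaps, and the union of their domains is an interval because all of
  -- them contain `t₀`.
  let F : (ℝ → M) → Set ℝ → Prop := fun γ' J' =>
    IsGeodesicOn cov γ' J' ∧ t₀ ∈ J' ∧ lift (n := n) γ' t₀ = lift γ₀ t₀
  let P : ℝ → Prop := fun t => ∃ q : (ℝ → M) × Set ℝ, F q.1 q.2 ∧ t ∈ q.2
  let γ : ℝ → M := fun t => if h : P t then h.choose.1 t else γ₀ t
  have hγ : ∀ γ' J', F γ' J' → EqOn γ γ' J' := by
    intro γ' J' hF t ht
    have hP : P t := ⟨(γ', J'), hF, ht⟩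
    obtain ⟨hF', ht'⟩ := hP.choose_spec
    have : γ t = hP.choose.1 t := dif_pos hP
    rw [this]
    exact congrArg (fun u : TangentBundle (𝓡 n) M => u.1)
      (hF'.1.lift_eqOn_inter hF.1 hF'.2.1 hF.2.1 (hF'.2.2.trans hF.2.2.symm) ⟨ht', ht⟩)
  refine ⟨γ, {t | P t}, isGeodesicOn_iff.2 ⟨?_, ⟨?_⟩, ⟨t₀, (γ₀, J₀), ⟨h₀, ht₀, rfl⟩, ht₀⟩, ?_⟩,
    fun γ' J' h1 h2 h3 => ⟨fun t ht => ⟨(γ', J'), ⟨h1, h2, h3⟩, ht⟩, hγ γ' J' ⟨h1, h2, h3⟩⟩⟩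
  · refine isOpen_iff_mem_nhds.2 ?_
    rintro t ⟨q, hq, ht⟩
    filter_upwards [hq.1.isOpen.mem_nhds ht] with s hs using ⟨q, hq, hs⟩
  · rintro x ⟨q, hq, hx⟩ y ⟨r, hr, hy⟩ z hz
    rcases le_total z t₀ with h | h
    · exact ⟨q, hq, hq.1.ordConnected.out hx hq.2.1 ⟨hz.1, h⟩⟩
    · exact ⟨r, hr, hr.1.ordConnected.out hr.2.1 hy ⟨h, hz.2⟩⟩
  · rintro t ⟨q, hq, ht⟩
    refine (hq.1.isGeodesicAt ht).congr ?_
    filter_upwards [hq.1.isOpen.mem_nhds ht] with s hs using (hγ _ _ hq hs).symm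

/-- A geodesic extends to an inextendible one. -/
lemma exists_isGeodesic_extension {γ₀ : ℝ → M} {J₀ : Set ℝ} (h₀ : IsGeodesicOn cov γ₀ J₀) :
    ∃ (γ : ℝ → M) (J : Set ℝ), IsGeodesic cov γ J ∧ J₀ ⊆ J ∧ EqOn γ γ₀ J₀ := by
  obtain ⟨t₀, ht₀⟩ := h₀.nonempty
  obtain ⟨γ, J, hγ, hmax⟩ := exists_largest_geodesic h₀ ht₀
  obtain ⟨h1, h2⟩ := hmax γ₀ J₀ h₀ ht₀ rfl
  refine ⟨γ, J, ⟨hγ, fun γ' J' h' hsub heq => ?_⟩, h1, h2⟩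
  refine Subset.antisymm (hmax γ' J' h' (hsub (h1 ht₀)) ?_).1 hsub
  rw [hγ.lift_eq_of_eqOn heq (h1 ht₀), h₀.lift_eq_of_eqOn h2 ht₀]

/-- An inextendible geodesic contains every geodesic with the same velocity at some time. -/
lemma IsGeodesic.subset {γ γ' : ℝ → M} {J J' : Set ℝ} (h : IsGeodesic cov γ J)
    (h' : IsGeodesicOn cov γ' J') {t : ℝ} (ht : t ∈ J) (ht' : t ∈ J')
    (he : lift (n := n) γ' t = lift γ t) : J' ⊆ J ∧ EqOn (lift (n := n) γ') (lift γ) J' := by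
  obtain ⟨η, K, hη, hmax⟩ := exists_largest_geodesic h.1 ht
  obtain ⟨h1, h2⟩ := hmax γ J h.1 ht rfl
  have hK : K = J := h.2 η K hη h1 h2
  have h3 := (hmax γ' J' h' ht' he).1.trans hK.subset
  refine ⟨h3, fun s hs => ?_⟩
  exact h'.lift_eqOn_inter h.1 ht' ht he ⟨hs, h3 hs⟩

variable (cov) in
/-- There is an inextendible geodesic with given initial velocity. -/
lemma exists_isGeodesic (u : TangentBundle (𝓡 n) M) (hu : u.2 ≠ 0) :
    ∃ (γ : ℝ → M) (J : Set ℝ), IsGeodesic cov γ J ∧ 0 ∈ J ∧ lift γ 0 = u := by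
  obtain ⟨N, hN, ε, hε, c, hc, -⟩ := exists_local_geodesic_flow cov u hu
  obtain ⟨h0, hgeo⟩ := hc u (mem_of_mem_nhds hN)
  have h0mem : (0 : ℝ) ∈ Ioo (-ε) ε := ⟨by linarith, hε⟩
  have hon : IsGeodesicOn cov (c u) (Ioo (-ε) ε) :=
    isGeodesicOn_iff.2 ⟨isOpen_Ioo, ordConnected_Ioo, ⟨0, h0mem⟩, hgeo⟩
  obtain ⟨γ, J, hγ, hsub, heq⟩ := exists_isGeodesic_extension hon
  exact ⟨γ, J, hγ, hsub h0mem, by rw [hon.lift_eq_of_eqOn heq h0mem, h0]⟩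

/-- Two inextendible geodesics with proportional velocities somewhere are affine
reparametrisations of each other. -/
lemma IsGeodesic.eq_affine {γ η : ℝ → M} {J K : Set ℝ} (hγ : IsGeodesic cov γ J)
    (hη : IsGeodesic cov η K) {s r : ℝ} (hs : s ∈ J) (hr : r ∈ K) {c : ℝ} (hc : c ≠ 0)
    (h : lift (n := n) γ s = scale c (lift η r)) :
    ∃ b : ℝ, c * s + b = r ∧ (∀ t, t ∈ J ↔ c * t + b ∈ K) ∧
      ∀ t ∈ J, lift (n := n) γ t = scale c (lift η (c * t + b)) := by
  have hrs : c * s + (r - c * s) = r := by ring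
  refine ⟨r - c * s, hrs, ?_⟩
  have hη' := hη.comp_affine hc (r - c * s)
  have hmem : s ∈ (fun s' => c * s' + (r - c * s)) ⁻¹' K := by rwa [mem_preimage, hrs]
  have hl : ∀ t ∈ (fun s' => c * s' + (r - c * s)) ⁻¹' K,
      lift (n := n) (fun s' => η (c * s' + (r - c * s))) t =
        scale c (lift η (c * t + (r - c * s))) := fun t ht =>
    (IsGeodesicAt.comp_affine hc (hη.1.isGeodesicAt ht)).2
  have hls := hl s hmem
  rw [hrs, ← h] at hls
  obtain ⟨h1, h2⟩ := hγ.subset hη'.1 hs hmem hls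
  obtain ⟨h3, -⟩ := hη'.subset hγ.1 hmem hs hls.symm
  exact ⟨fun t => ⟨fun ht => h3 ht, fun ht => h1 ht⟩, fun t ht => by
    rw [← h2 (h3 ht), hl t (h3 ht)]⟩

end Maximal

/-! ### The equivalence relation defining the space of geodesics, and openness of the projection -/

section Quotient

variable (cov : LinearConnection n M)

/-- Two nonzero tangent vectors are tangent to a common inextendible geodesic. -/
def Tangent (u v : TangentBundle (𝓡 n) M) : Prop :=
  ∃ (γ : ℝ → M) (J : Set ℝ), IsGeodesic cov γ J ∧ ∃ s ∈ J, ∃ t ∈ J, ∃ c ≠ (0 : ℝ), ∃ d ≠ (0 : ℝ),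
    u = scale c (lift γ s) ∧ v = scale d (lift γ t)

variable {cov}

lemma Tangent.symm {u v : TangentBundle (𝓡 n) M} (h : Tangent cov u v) : Tangent cov v u := by
  obtain ⟨γ, J, hγ, s, hs, t, ht, c, hc, d, hd, hu, hv⟩ := h
  exact ⟨γ, J, hγ, t, ht, s, hs, d, hd, c, hc, hv, hu⟩

variable [T2Space M] [CovariantDerivative.ContMDiffCovariantDerivative cov ∞]

lemma tangent_refl {u : TangentBundle (𝓡 n) M} (hu : u.2 ≠ 0) : Tangent cov u u := by
  obtain ⟨γ, J, hγ, h0, h⟩ := exists_isGeodesic cov u hu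
  exact ⟨γ, J, hγ, 0, h0, 0, h0, 1, one_ne_zero, 1, one_ne_zero, by rw [h, scale_one],
    by rw [h, scale_one]⟩

/-- A vector tangent to the same geodesic as a velocity of `γ` is tangent to `γ`. -/
lemma Tangent.exists_eq {u v : TangentBundle (𝓡 n) M} (h : Tangent cov u v) {γ : ℝ → M}
    {J : Set ℝ} (hγ : IsGeodesic cov γ J) {s : ℝ} (hs : s ∈ J) {c : ℝ} (hc : c ≠ 0)
    (hu : u = scale c (lift γ s)) : ∃ t ∈ J, ∃ d ≠ (0 : ℝ), v = scale d (lift γ t) := by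
  obtain ⟨η, K, hη, r, hr, q, hq, a, ha, b, hb, hu', hv⟩ := h
  have h1 : lift (n := n) η r = scale (a⁻¹ * c) (lift γ s) := by
    rw [← scale_scale, ← hu, hu', scale_inv_scale ha]
  obtain ⟨e, -, h2, h3⟩ := hη.eq_affine hγ hr hs (mul_ne_zero (inv_ne_zero ha) hc) h1
  exact ⟨_, (h2 q).1 hq, b * (a⁻¹ * c), mul_ne_zero hb (mul_ne_zero (inv_ne_zero ha) hc), by
    rw [hv, h3 q hq, scale_scale]⟩

lemma Tangent.trans {u v w : TangentBundle (𝓡 n) M} (h : Tangent cov u v) (h' : Tangent cov v w) :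
    Tangent cov u w := by
  obtain ⟨γ, J, hγ, s, hs, t, ht, c, hc, d, hd, hu, hv⟩ := h
  obtain ⟨r, hr, e, he, hw⟩ := h'.exists_eq hγ ht hd hv
  exact ⟨γ, J, hγ, s, hs, r, hr, c, hc, e, he, hu, hw⟩

lemma tangent_scale {u : TangentBundle (𝓡 n) M} (hu : u.2 ≠ 0) {c : ℝ} (hc : c ≠ 0) :
    Tangent cov u (scale c u) := by
  obtain ⟨γ, J, hγ, h0, h⟩ := exists_isGeodesic cov u hu
  exact ⟨γ, J, hγ, 0, h0, 0, h0, 1, one_ne_zero, c, hc, by rw [h, scale_one], by rw [h]⟩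

lemma tangent_lift {γ : ℝ → M} {J : Set ℝ} (hγ : IsGeodesic cov γ J) {s t : ℝ} (hs : s ∈ J)
    (ht : t ∈ J) : Tangent cov (lift γ s) (lift γ t) :=
  ⟨γ, J, hγ, s, hs, t, ht, 1, one_ne_zero, 1, one_ne_zero, by rw [scale_one], by rw [scale_one]⟩

omit [T2Space M] [CovariantDerivative.ContMDiffCovariantDerivative cov ∞] in
lemma IsGeodesic.lift_snd_ne_zero {γ : ℝ → M} {J : Set ℝ} (hγ : IsGeodesic cov γ J) {t : ℝ}
    (ht : t ∈ J) : (lift (n := n) γ t).2 ≠ 0 := hγ.1.velocity_ne_zero t ht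

/-- The quotient is taken by the equivalence relation generated by proportionality and
`OnCommonGeodesic`. As `Tangent` is already an equivalence relation on nonzero vectors, by
uniqueness of inextendible geodesics, nothing more is identified. -/
lemma toGeodesicSpace_eq_iff {u v : ReducedTangentBundle n M} :
    toGeodesicSpace cov u = toGeodesicSpace cov v ↔ Tangent cov u.1 v.1 := by
  constructor
  · intro h
    let S : Setoid (ReducedTangentBundle n M) :=
      { r := fun u v => Tangent cov u.1 v.1
        iseqv := ⟨fun u => tangent_refl u.2, Tangent.symm, Tangent.trans⟩ }
    have h1 : ∀ u v : ReducedTangentBundle n M, (proportional n M).r u v →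
        Quotient.mk S u = Quotient.mk S v := by
      rintro u v ⟨c, hc, h⟩
      refine Quotient.sound (s := S) ?_
      change Tangent cov u.1 v.1
      rw [h]
      exact tangent_scale u.2 hc
    let f : ProjectiveTangentBundle n M → Quotient S := Quotient.lift (Quotient.mk S) h1
    have h2 : ∀ a b, OnCommonGeodesic cov a b → f a = f b := by
      rintro _ _ ⟨γ, J, hγ, s, hs, t, ht, u, v, hu, hv, rfl, rfl⟩
      refine Quotient.sound (s := S) ?_
      change Tangent cov u.1 v.1
      rw [hu, hv]
      exact tangent_lift hγ hs ht
    exact Quotient.exact (s := S) (congrArg (Quot.lift f h2) h)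
  · rintro ⟨γ, J, hγ, s, hs, t, ht, c, hc, d, hd, hu, hv⟩
    let u' : ReducedTangentBundle n M := ⟨lift γ s, hγ.lift_snd_ne_zero hs⟩
    let v' : ReducedTangentBundle n M := ⟨lift γ t, hγ.lift_snd_ne_zero ht⟩
    have h1 : (Quotient.mk _ u' : ProjectiveTangentBundle n M) = Quotient.mk _ u :=
      Quotient.sound ⟨c, hc, hu⟩
    have h2 : (Quotient.mk _ v' : ProjectiveTangentBundle n M) = Quotient.mk _ v :=
      Quotient.sound ⟨d, hd, hv⟩
    exact Quot.sound ⟨γ, J, hγ, s, hs, t, ht, u', v', rfl, rfl, h1, h2⟩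

omit [T2Space M] [CovariantDerivative.ContMDiffCovariantDerivative cov ∞] in
lemma continuous_toGeodesicSpace : Continuous (toGeodesicSpace cov) :=
  continuous_quot_mk.comp continuous_quotient_mk'

omit [T2Space M] [CovariantDerivative.ContMDiffCovariantDerivative cov ∞] in
lemma surjective_toGeodesicSpace : Function.Surjective (toGeodesicSpace cov) :=
  Quot.mk_surjective.comp Quotient.mk_surjective

omit [T2Space M] [CovariantDerivative.ContMDiffCovariantDerivative cov ∞] in
lemma isOpen_geodesicSpace_iff {A : Set (GeodesicSpace cov)} :
    IsOpen A ↔ IsOpen (toGeodesicSpace cov ⁻¹' A) := by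
  rw [← isQuotientMap_quot_mk.isOpen_preimage, ← isQuotientMap_quotient_mk'.isOpen_preimage]
  rfl

/-- The interior of a set that is saturated for the geodesic flow is invariant along geodesics. -/
lemma IsGeodesic.lift_mem_interior {B : Set (TangentBundle (𝓡 n) M)}
    (hB : ∀ u v, Tangent cov u v → u ∈ B → v ∈ B) {γ : ℝ → M} {J : Set ℝ}
    (hγ : IsGeodesic cov γ J) {s t : ℝ} (hs : s ∈ J) (ht : t ∈ J)
    (h : lift γ s ∈ interior B) : lift γ t ∈ interior B := by
  -- Along the interval `J` it is enough that membership in the interior is locally constant in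
  -- time. Only the local flow around `lift γ x` is then needed.
  refine (hγ.1.ordConnected.isPreconnected.induction₂
    (fun x y => lift γ x ∈ interior B ↔ lift γ y ∈ interior B) ?_ (fun x y z _ _ _ => Iff.trans)
    (fun x y _ _ => Iff.symm) hs ht).1 h
  intro x hx
  refine Filter.Eventually.filter_mono nhdsWithin_le_nhds ?_
  obtain ⟨N, hN, ε, hε, c, hc, hcc⟩ :=
    exists_local_geodesic_flow cov (lift γ x) (hγ.lift_snd_ne_zero hx)
  have hshift : ∀ᶠ y in 𝓝 x, y - x ∈ Ioo (-ε) ε := by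
    filter_upwards [Ioo_mem_nhds (sub_lt_self x hε) (lt_add_of_pos_right x hε)] with y hy
    exact ⟨by linarith [hy.1], by linarith [hy.2]⟩
  have hcont := IsGeodesicAt.continuousAt_lift (hγ.1.eventually_isGeodesicAt hx)
  have hstep : lift (n := n) γ x ∈ interior B → ∀ᶠ y in 𝓝 x, lift γ y ∈ interior B := fun h =>
    hcont.eventually (isOpen_interior.mem_nhds h)
  by_cases hxB : lift γ x ∈ interior B
  · filter_upwards [hstep hxB] with y hy using ⟨fun _ => hy, fun _ => hxB⟩
  filter_upwards [hshift, hγ.1.isOpen.mem_nhds hx] with y hy hyJ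
  -- Flowing for the time `y - x` is continuous near `lift γ x` and sends it to `lift γ y`. The
  -- preimage of `B` is therefore a neighbourhood of `lift γ x`, and it lies in `B` near that point
  -- because `B` is saturated.
  refine ⟨fun h => absurd h hxB, fun hyB => ?_⟩
  have h0 : (0 : ℝ) ∈ Ioo (-ε) ε := ⟨by linarith, hε⟩
  have hon : ∀ u ∈ N, IsGeodesicOn cov (c u) (Ioo (-ε) ε) := fun u hu =>
    isGeodesicOn_iff.2 ⟨isOpen_Ioo, ordConnected_Ioo, ⟨0, h0⟩, (hc u hu).2⟩
  have hflow : ∀ u ∈ N, Tangent cov (lift (c u) (y - x)) u := by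
    intro u hu
    obtain ⟨η, K, hη, hsub, heq⟩ := exists_isGeodesic_extension (hon u hu)
    have h1 := tangent_lift hη (hsub hy) (hsub h0)
    rwa [(hon u hu).lift_eq_of_eqOn heq hy, (hon u hu).lift_eq_of_eqOn heq h0, (hc u hu).1] at h1
  have hxN := mem_of_mem_nhds hN
  have hend : lift (n := n) (c (lift γ x)) (y - x) = lift γ y := by
    have hγ' := hγ.comp_affine one_ne_zero x
    have h0' : (0 : ℝ) ∈ (fun s => 1 * s + x) ⁻¹' J := by simpa using hx
    have hl : ∀ r, 1 * r + x ∈ J → lift (n := n) (fun s => γ (1 * s + x)) r = lift γ (1 * r + x) :=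
      fun r hr => by
        rw [(IsGeodesicAt.comp_affine one_ne_zero (hγ.1.isGeodesicAt hr)).2, scale_one]
    have h1 := (hγ'.subset (hon _ hxN) h0' h0 (by
      rw [(hc _ hxN).1, hl 0 h0']; simp)).2 hy
    rw [h1, hl _ (by simpa using hyJ)]
    simp
  have hca : ContinuousAt (fun u => lift (n := n) (c u) (y - x)) (lift γ x) :=
    (hcc _ hy).continuousAt hN
  rw [mem_interior_iff_mem_nhds]
  have hpre : (fun u => lift (n := n) (c u) (y - x)) ⁻¹' B ∈ 𝓝 (lift (n := n) γ x) :=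
    hca (by
      change B ∈ 𝓝 (lift (c (lift γ x)) (y - x))
      rw [hend]
      exact mem_interior_iff_mem_nhds.1 hyB)
  filter_upwards [hpre, hN] with u hu huN
  exact hB _ _ (hflow u huN) hu

/-- The saturation of an open set is open: it contains the open set in its interior, the interior
propagates along geodesics, and rescaling is a homeomorphism that preserves saturated sets of
nonzero vectors. -/
lemma isOpenMap_toGeodesicSpace : IsOpenMap (toGeodesicSpace cov) := by
  intro O hO
  rw [isOpen_geodesicSpace_iff]
  let B : Set (TangentBundle (𝓡 n) M) := {v | ∃ u ∈ O, Tangent cov u.1 v}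
  have hBeq : toGeodesicSpace cov ⁻¹' (toGeodesicSpace cov '' O) = Subtype.val ⁻¹' B := by
    ext v
    constructor
    · rintro ⟨u, hu, h⟩
      exact ⟨u, hu, toGeodesicSpace_eq_iff.1 h⟩
    · rintro ⟨u, hu, h⟩
      exact ⟨u, hu, toGeodesicSpace_eq_iff.2 h⟩
  have hB : ∀ u v, Tangent cov u v → u ∈ B → v ∈ B := by
    rintro u v h ⟨w, hw, h'⟩
    exact ⟨w, hw, h'.trans h⟩
  have hBne : ∀ u ∈ B, u.2 ≠ 0 := by
    rintro _ ⟨w, hw, γ, J, hγ, s, hs, t, ht, c, hc, d, hd, hu, rfl⟩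
    exact (scale_snd_ne_zero hd).2 (hγ.lift_snd_ne_zero ht)
  rw [hBeq]
  refine IsOpen.preimage continuous_subtype_val ?_
  refine isOpen_iff_mem_nhds.2 ?_
  rintro v ⟨u, hu, h⟩
  obtain ⟨γ, J, hγ, h0, hl⟩ := exists_isGeodesic cov u.1 u.2
  obtain ⟨t, ht, d, hd, hv⟩ := h.exists_eq hγ h0 one_ne_zero (by rw [hl, scale_one])
  have hint : lift γ 0 ∈ interior B := by
    rw [hl, mem_interior]
    refine ⟨Subtype.val '' O, ?_, (ReducedTangentBundle n M).isOpen.isOpenMap_subtype_val O hO,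
      ⟨u, hu, rfl⟩⟩
    rintro _ ⟨w, hw, rfl⟩
    exact ⟨w, hw, tangent_refl w.2⟩
  have ht' := mem_interior_iff_mem_nhds.1 (hγ.lift_mem_interior hB h0 ht hint)
  have hpre : scale d⁻¹ ⁻¹' B ∈ 𝓝 v := (continuous_scale d⁻¹).continuousAt (by
    rw [hv, scale_inv_scale hd]
    exact ht')
  filter_upwards [hpre] with w hw
  have h3 := tangent_scale (cov := cov) (hBne _ hw) hd
  rw [scale_scale, mul_inv_cancel₀ hd, scale_one] at h3
  exact hB _ _ h3 hw

end Quotient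

/-! ### Connectedness and countability of the space of geodesics -/

section Topology

/-- A connected paracompact locally compact Hausdorff space is σ-compact. -/
lemma sigmaCompactSpace_of_connected_paracompact (X : Type*) [TopologicalSpace X] [T2Space X]
    [ParacompactSpace X] [LocallyCompactSpace X] [ConnectedSpace X] : SigmaCompactSpace X := by
  classical
  have hex : ∀ x : X, ∃ U : Set X, IsOpen U ∧ x ∈ U ∧ IsCompact (closure U) := fun x => by
    obtain ⟨U, h1, h2, h3⟩ := exists_isOpen_superset_and_isCompact_closure
      (isCompact_singleton (x := x))
    exact ⟨U, h1, h2 rfl, h3⟩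
  choose U hUo hxU hUc using hex
  obtain ⟨V, hVo, hVcov, hVlf, hVU⟩ := precise_refinement U hUo
    (eq_univ_of_forall fun x => mem_iUnion.2 ⟨x, hxU x⟩)
  have hVc : ∀ i, IsCompact (closure (V i)) := fun i =>
    (hUc i).of_isClosed_subset isClosed_closure (closure_mono (hVU i))
  obtain ⟨x₀⟩ := (inferInstance : Nonempty X)
  -- Starting from a point, repeatedly adjoin the closures of all members of a locally finite,
  -- relatively compact cover that meet the present set. Each stage is compact, and the union of all
  -- stages is clopen, hence everything.
  let step : Set X → Set X := fun K => ⋃ i ∈ {i | (V i ∩ K).Nonempty}, closure (V i)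
  let K : ℕ → Set X := fun m => step^[m] {x₀}
  have hKs : ∀ m, K (m + 1) = step (K m) := fun m => Function.iterate_succ_apply' step m _
  have hKc : ∀ m, IsCompact (K m) := by
    intro m
    induction m with
    | zero => exact isCompact_singleton
    | succ m ih =>
      rw [hKs]
      exact (hVlf.finite_nonempty_inter_compact ih).isCompact_biUnion fun i _ => hVc i
  have hVK : ∀ m i, (V i ∩ K m).Nonempty → V i ⊆ K (m + 1) := by
    intro m i h
    rw [hKs]
    exact subset_closure.trans (subset_biUnion_of_mem (u := fun i => closure (V i)) h)
  have hmem : ∀ x, ∃ i, x ∈ V i := fun x => mem_iUnion.1 (hVcov ▸ mem_univ x)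
  have hclopen : IsClopen (⋃ m, K m) := by
    constructor
    · refine isClosed_of_closure_subset fun y hy => ?_
      obtain ⟨i, hi⟩ := hmem y
      obtain ⟨z, hz, hzK⟩ := mem_closure_iff.1 hy (V i) (hVo i) hi
      obtain ⟨m, hm⟩ := mem_iUnion.1 hzK
      exact mem_iUnion.2 ⟨m + 1, hVK m i ⟨z, hz, hm⟩ hi⟩
    · refine isOpen_iff_mem_nhds.2 fun y hy => ?_
      obtain ⟨m, hm⟩ := mem_iUnion.1 hy
      obtain ⟨i, hi⟩ := hmem y
      filter_upwards [(hVo i).mem_nhds hi] with z hz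
      exact mem_iUnion.2 ⟨m + 1, hVK m i ⟨y, hi, hm⟩ hz⟩
  have huniv : (⋃ m, K m) = univ := hclopen.eq_univ ⟨x₀, mem_iUnion.2 ⟨0, rfl⟩⟩
  exact ⟨⟨K, hKc, huniv⟩⟩

variable (n M) in
lemma secondCountableTopology_tangentBundle [T2Space M] [ParacompactSpace M] [ConnectedSpace M] :
    SecondCountableTopology (TangentBundle (𝓡 n) M) := by
  have : LocallyCompactSpace M := ChartedSpace.locallyCompactSpace 𝔼 M
  have : SigmaCompactSpace M := sigmaCompactSpace_of_connected_paracompact M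
  obtain ⟨s, hsc, hs⟩ := countable_cover_nhds_of_sigmaCompact
    fun x : M => chart_source_mem_nhds 𝔼 x
  -- A chart of the tangent bundle covers the whole preimage of a chart of `M`, so the charts at
  -- zero vectors over a countable set of points suffice.
  let z : M → TangentBundle (𝓡 n) M := fun x => ⟨x, 0⟩
  have : SecondCountableTopology (ModelProd 𝔼 𝔼) :=
    inferInstanceAs (SecondCountableTopology (𝔼 × 𝔼))
  refine ChartedSpace.secondCountable_of_countable_cover (ModelProd 𝔼 𝔼) (s := z '' s) ?_
    (hsc.image z)
  refine eq_univ_of_forall fun u => ?_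
  obtain ⟨x, hx, hux⟩ := mem_iUnion₂.1 (hs ▸ mem_univ u.1 : u.1 ∈ ⋃ x ∈ s, (chartAt 𝔼 x).source)
  refine mem_iUnion₂.2 ⟨z x, ⟨x, hx, rfl⟩, ?_⟩
  rw [TangentBundle.mem_chart_source_iff]
  exact hux

variable {cov : LinearConnection n M}

lemma toGeodesicSpace_eq_of_proportional {u v : ReducedTangentBundle n M} {c : ℝ} (hc : c ≠ 0)
    (h : v.1 = scale c u.1) : toGeodesicSpace cov u = toGeodesicSpace cov v :=
  congrArg (Quot.mk (OnCommonGeodesic cov)) (Quotient.sound (s := proportional n M) ⟨c, hc, h⟩)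

/-- The fibre of `T'M` is disconnected when `n = 1`, but its image in `G(M)` is connected:
proportional vectors are identified there, and nonproportional ones are joined by a segment that
avoids zero. -/
lemma toGeodesicSpace_mem_of_isClopen {A : Set (GeodesicSpace cov)} (hA : IsClopen A)
    {u v : ReducedTangentBundle n M} (h : u.1.1 = v.1.1) (hu : toGeodesicSpace cov u ∈ A) :
    toGeodesicSpace cov v ∈ A := by
  obtain ⟨⟨x, u⟩, hu0⟩ := u
  obtain ⟨⟨y, v⟩, hv0⟩ := v
  obtain rfl : x = y := h
  have hu0' : u ≠ 0 := hu0
  have hv0' : v ≠ 0 := hv0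
  by_cases hprop : ∃ c : ℝ, c • u = v
  · obtain ⟨c, hc⟩ := hprop
    have hc0 : c ≠ 0 := by
      rintro rfl
      rw [zero_smul] at hc
      exact hv0' hc.symm
    rwa [toGeodesicSpace_eq_of_proportional hc0 (u := ⟨⟨x, u⟩, hu0⟩) (v := ⟨⟨x, v⟩, hv0⟩)
      (congrArg (TotalSpace.mk x) hc.symm)] at hu
  have hne : ∀ t : ℝ, (1 - t) • u + t • v ≠ 0 := by
    intro t ht
    by_cases h0 : t = 0
    · rw [h0, sub_zero, one_smul, zero_smul, add_zero] at ht
      exact hu0' ht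
    · refine hprop ⟨t⁻¹ * (t - 1), ?_⟩
      have h1 : t • v = (t - 1) • u := by
        rw [← sub_eq_zero, ← ht]
        module
      rw [← smul_smul, ← h1, smul_smul, inv_mul_cancel₀ h0, one_smul]
  let f : ℝ → ReducedTangentBundle n M := fun t => ⟨⟨x, (1 - t) • u + t • v⟩, hne t⟩
  have hf : Continuous f := by
    refine Continuous.subtype_mk ?_ _
    exact (FiberBundle.continuous_totalSpaceMk 𝔼 (fun x : M => TangentSpace (𝓡 n) x) x).comp
      (by fun_prop)
  have hcl : IsClopen ((fun t => toGeodesicSpace cov (f t)) ⁻¹' A) :=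
    hA.preimage (continuous_toGeodesicSpace.comp hf)
  have h0 : f 0 = ⟨⟨x, u⟩, hu0⟩ := Subtype.ext (by simp [f])
  have h1 : f 1 = ⟨⟨x, v⟩, hv0⟩ := Subtype.ext (by simp [f])
  have huniv := hcl.eq_univ ⟨0, by rwa [mem_preimage, h0]⟩
  have := huniv ▸ mem_univ (1 : ℝ)
  rwa [mem_preimage, h1] at this

-- If a clopen set and its complement were both nonempty, the base points of their tangent vectors
-- would form two nonempty open sets covering `M`. These would meet, against the connectedness of
-- the image of each fibre.
variable (cov) in
lemma connectedSpace_geodesicSpace [ConnectedSpace M] [Nonempty (GeodesicSpace cov)] :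
    ConnectedSpace (GeodesicSpace cov) := by
  obtain ⟨g₀⟩ := ‹Nonempty (GeodesicSpace cov)›
  obtain ⟨u₀, -⟩ := surjective_toGeodesicSpace g₀
  -- All tangent spaces are the same model space, so one nonzero vector somewhere supplies one at
  -- every point.
  have hfib : ∀ x : M, ∃ u : ReducedTangentBundle n M, u.1.1 = x := fun x =>
    ⟨⟨⟨x, (u₀.1.2 : 𝔼)⟩, u₀.2⟩, rfl⟩
  have hopen : ∀ B : Set (ReducedTangentBundle n M), IsOpen B →
      IsOpen ((fun u : ReducedTangentBundle n M => u.1.1) '' B) := by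
    intro B hB
    have h := FiberBundle.isOpenMap_proj 𝔼 (fun x : M => TangentSpace (𝓡 n) x) _
      ((ReducedTangentBundle n M).isOpen.isOpenMap_subtype_val B hB)
    rwa [image_image] at h
  have hpre : PreconnectedSpace (GeodesicSpace cov) := by
    rw [preconnectedSpace_iff_clopen]
    intro A hA
    by_contra! hcon
    obtain ⟨⟨a, ha⟩, hne⟩ := hcon
    obtain ⟨b, hb⟩ := (ne_univ_iff_exists_notMem _).1 hne
    obtain ⟨u, rfl⟩ := surjective_toGeodesicSpace a
    obtain ⟨v, rfl⟩ := surjective_toGeodesicSpace b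
    obtain ⟨x, -, ⟨w, hw, hwx⟩, ⟨w', hw', hwx'⟩⟩ := (isPreconnected_univ (α := M)) _ _
      (hopen _ (hA.isOpen.preimage continuous_toGeodesicSpace))
      (hopen _ (hA.compl.isOpen.preimage continuous_toGeodesicSpace))
      (fun x _ => by
        obtain ⟨w, rfl⟩ := hfib x
        by_cases hw : toGeodesicSpace cov w ∈ A
        · exact Or.inl ⟨w, hw, rfl⟩
        · exact Or.inr ⟨w, hw, rfl⟩)
      ⟨u.1.1, mem_univ _, u, ha, rfl⟩ ⟨v.1.1, mem_univ _, v, hb, rfl⟩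
    exact hw' (toGeodesicSpace_mem_of_isClopen hA (hwx.trans hwx'.symm) hw)
  exact { hpre with toNonempty := ⟨g₀⟩ }

variable (cov) in
lemma secondCountableTopology_geodesicSpace [T2Space M] [ParacompactSpace M] [ConnectedSpace M]
    [CovariantDerivative.ContMDiffCovariantDerivative cov ∞] :
    SecondCountableTopology (GeodesicSpace cov) := by
  have := secondCountableTopology_tangentBundle n M
  have : SecondCountableTopology (ReducedTangentBundle n M) :=
    TopologicalSpace.Subtype.secondCountableTopology _
  exact (isOpenMap_toGeodesicSpace.isQuotientMap continuous_toGeodesicSpace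
    surjective_toGeodesicSpace).secondCountableTopology isOpenMap_toGeodesicSpace

end Topology

/-! ### Geodesics of a nonreturning manifold -/

section Nonreturning

variable {cov : LinearConnection n M}

lemma IsGeodesicOn.mdifferentiableAt {γ : ℝ → M} {J : Set ℝ} (hγ : IsGeodesicOn cov γ J) {t : ℝ}
    (ht : t ∈ J) : MDifferentiableAt 𝓘(ℝ, ℝ) (𝓡 n) γ t := (hγ.isGeodesicAt ht).mdifferentiableAt

lemma coordVec_velocity_ne_zero {γ : ℝ → M} {J : Set ℝ} (hγ : IsGeodesicOn cov γ J) {t : ℝ}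
    (ht : t ∈ J) {x₀ : M} (hx : γ t ∈ (chartAt 𝔼 x₀).source) :
    coordVec (n := n) x₀ (γ t) (velocity γ t) ≠ 0 :=
  fun h => hγ.velocity_ne_zero t ht ((coordVec_eq_zero_iff hx _).1 h)

lemma IsGeodesicOn.eventually_ne {γ : ℝ → M} {J : Set ℝ} (hγ : IsGeodesicOn cov γ J) {t : ℝ}
    (ht : t ∈ J) : ∀ᶠ s in 𝓝[≠] t, γ s ≠ γ t := by
  have hx : γ t ∈ (chartAt 𝔼 (γ t)).source := mem_chart_source _ _
  have h := (hasDerivAt_extChartAt_comp (hγ.mdifferentiableAt ht) hx).eventually_ne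
    (c := extChartAt (𝓡 n) (γ t) (γ t)) (coordVec_velocity_ne_zero hγ ht hx)
  filter_upwards [h] with s hs heq
  exact hs (congrArg _ heq)

/-- In a nonreturning manifold, points of a geodesic that are close in `M` are close in time. -/
lemma Nonreturning.exists_nhds_subset_Ioo [T1Space M] (hM : Nonreturning cov) {γ : ℝ → M}
    {J : Set ℝ} (hγ : IsGeodesic cov γ J) {t : ℝ} (ht : t ∈ J) {δ : ℝ} (hδ : 0 < δ) :
    ∃ U ∈ 𝓝 (γ t), J ∩ γ ⁻¹' U ⊆ Ioo (t - δ) (t + δ) := by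
  obtain ⟨r, hr, hball⟩ := Metric.eventually_nhds_iff.1
    (eventually_nhdsWithin_iff.1 (hγ.1.eventually_ne ht))
  -- Since `γ` is an immersion, it differs from `γ t` at the times `t ± ε`. A nonreturning
  -- neighbourhood omitting both values confines its interval of times, which contains `t`, between
  -- them.
  set ε := min δ (r / 2) with hε
  have hε0 : 0 < ε := lt_min hδ (by linarith)
  have hεr : ε < r := (min_le_right _ _).trans_lt (by linarith)
  have h1 : γ (t - ε) ≠ γ t := hball (by simpa [abs_of_pos hε0] using hεr) (by simpa using hε0.ne')
  have h2 : γ (t + ε) ≠ γ t := hball (by simpa [abs_of_pos hε0] using hεr) (by simpa using hε0.ne')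
  obtain ⟨U, hU, hUsub, hord⟩ := hM (γ t) ({γ (t - ε)}ᶜ ∩ {γ (t + ε)}ᶜ)
    (Filter.inter_mem (isOpen_compl_singleton.mem_nhds h1.symm)
      (isOpen_compl_singleton.mem_nhds h2.symm))
  have hord := hord γ J hγ
  have htU : t ∈ J ∩ γ ⁻¹' U := ⟨ht, mem_preimage.2 (mem_of_mem_nhds hU)⟩
  refine ⟨U, hU, fun s hs => ⟨?_, ?_⟩⟩
  · refine lt_of_le_of_lt (sub_le_sub_left (min_le_left _ _ : ε ≤ δ) t) ?_
    by_contra! hle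
    exact (hUsub (hord.out hs htU ⟨hle, by linarith⟩).2).1 rfl
  · refine lt_of_lt_of_le ?_ (add_le_add_right (min_le_left _ _ : ε ≤ δ) t)
    by_contra! hle
    exact (hUsub (hord.out htU hs ⟨by linarith, hle⟩).2).2 rfl

lemma Nonreturning.injOn [T1Space M] (hM : Nonreturning cov) {γ : ℝ → M} {J : Set ℝ}
    (hγ : IsGeodesic cov γ J) : InjOn γ J := by
  intro s hs t ht h
  by_contra hne
  obtain ⟨U, hU, hsub⟩ := hM.exists_nhds_subset_Ioo hγ ht (abs_pos.2 (sub_ne_zero.2 hne))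
  have := hsub ⟨hs, by rw [mem_preimage, h]; exact mem_of_mem_nhds hU⟩
  rcases abs_cases (s - t) with h' | h' <;> linarith [this.1, this.2]

end Nonreturning

/-! ### Differentiability and monotonicity of a reparametrisation -/

section Calculus

/-- If `c` is an immersed curve and `c ∘ φ` is differentiable then so is the continuous function
`φ`. -/
lemma hasDerivAt_of_comp {E : Type*} [NormedAddCommGroup E] [InnerProductSpace ℝ E] {c g : ℝ → E}
    {φ : ℝ → ℝ} {t : ℝ} {v : E} (hc : ContDiffAt ℝ 1 c (φ t)) (hc' : deriv c (φ t) ≠ 0)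
    (hφ : ContinuousAt φ t) (hg : HasDerivAt g v t) (h : ∀ᶠ s in 𝓝 t, c (φ s) = g s) :
    DifferentiableAt ℝ φ t := by
  -- Pairing with `w` turns `c` into a real function with derivative `⟪w, w⟫ ≠ 0` at `φ t`. It has a
  -- differentiable local inverse, and continuity of `φ` keeps nearby values in the range where that
  -- inverse applies.
  set w := deriv c (φ t)
  have hcs : HasStrictDerivAt c w (φ t) := hc.hasStrictDerivAt one_ne_zero
  have hf : HasStrictDerivAt (fun s => innerSL ℝ w (c s)) (innerSL ℝ w w) (φ t) :=
    ((innerSL ℝ w).hasStrictFDerivAt.comp_hasStrictDerivAt (φ t) hcs)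
  have hw : innerSL ℝ w w ≠ 0 := by simpa using hc'
  have hk : HasDerivAt (fun s => innerSL ℝ w (g s)) (innerSL ℝ w v) t :=
    (innerSL ℝ w).hasFDerivAt.comp_hasDerivAt t hg
  have hinv := (hf.to_localInverse hw).hasDerivAt
  have hleft : ∀ᶠ s in 𝓝 (φ t), hf.localInverse _ _ _ hw (innerSL ℝ w (c s)) = s :=
    (hf.hasStrictFDerivAt_equiv hw).eventually_left_inverse
  have ht : innerSL ℝ w (c (φ t)) = innerSL ℝ w (g t) := by rw [h.self_of_nhds]
  rw [ht] at hinv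
  refine ((hinv.comp t hk).congr_of_eventuallyEq ?_).differentiableAt
  filter_upwards [h, hφ.eventually hleft] with s hs hs'
  rw [Function.comp_apply, ← hs, hs']

/-- By Darboux's theorem a nowhere vanishing derivative has constant sign, even without being
continuous. -/
lemma strictMonoOn_or_strictAntiOn_of_deriv_ne_zero {J : Set ℝ} (hJ : IsOpen J)
    (hJ' : J.OrdConnected) {φ : ℝ → ℝ} (hφ : ∀ t ∈ J, DifferentiableAt ℝ φ t)
    (h : ∀ t ∈ J, deriv φ t ≠ 0) : StrictMonoOn φ J ∨ StrictAntiOn φ J := by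
  have hc : ContinuousOn φ J := fun t ht => (hφ t ht).continuousAt.continuousWithinAt
  rcases hasDerivWithinAt_forall_lt_or_forall_gt_of_forall_ne hJ'.convex
    (fun t ht => (hφ t ht).hasDerivAt.hasDerivWithinAt) h with h | h
  · exact Or.inr (strictAntiOn_of_deriv_neg hJ'.convex hc (by rwa [hJ.interior_eq]))
  · exact Or.inl (strictMonoOn_of_deriv_pos hJ'.convex hc (by rwa [hJ.interior_eq]))

end Calculus

/-! ### Geodesics of the covering space as lifts of geodesics -/

section Covering

variable {M' : Type*} [TopologicalSpace M'] [ChartedSpace (EuclideanSpace ℝ (Fin n)) M'] [IsManifold (𝓡 n) ∞ M']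

lemma tangentMap_scale (p : M' → M) (c : ℝ) (u : TangentBundle (𝓡 n) M') :
    tangentMap (𝓡 n) (𝓡 n) p (scale c u) = scale c (tangentMap (𝓡 n) (𝓡 n) p u) :=
  congrArg (TotalSpace.mk (p u.1)) ((mfderiv (𝓡 n) (𝓡 n) p u.1).map_smul c u.2)

lemma injective_mfderiv {p : M' → M} (hp : IsLocalDiffeomorph (𝓡 n) (𝓡 n) ∞ p) (x : M') :
    Function.Injective (mfderiv (𝓡 n) (𝓡 n) p x) := by
  have h := ((hp x).mfderivToContinuousLinearEquiv (by simp)).injective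
  have h' := (hp x).mfderivToContinuousLinearEquiv_coe (by simp)
  rw [← h']
  exact h

lemma tangentMap_snd_ne_zero {p : M' → M} (hp : IsLocalDiffeomorph (𝓡 n) (𝓡 n) ∞ p)
    {u : TangentBundle (𝓡 n) M'} (hu : u.2 ≠ 0) : (tangentMap (𝓡 n) (𝓡 n) p u).2 ≠ 0 :=
  fun h => hu ((injective_mfderiv hp u.1) (h.trans (map_zero _).symm))

lemma eq_of_tangentMap_eq {p : M' → M} (hp : IsLocalDiffeomorph (𝓡 n) (𝓡 n) ∞ p)
    {u v : TangentBundle (𝓡 n) M'} (hb : u.1 = v.1)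
    (h : tangentMap (𝓡 n) (𝓡 n) p u = tangentMap (𝓡 n) (𝓡 n) p v) : u = v := by
  obtain ⟨x, u⟩ := u
  obtain ⟨y, v⟩ := v
  obtain rfl : x = y := hb
  have h2 : mfderiv (𝓡 n) (𝓡 n) p x u = mfderiv (𝓡 n) (𝓡 n) p x v := by
    simpa [tangentMap] using h
  rw [injective_mfderiv hp x h2]

lemma lift_comp {p : M' → M} (hp : IsLocalDiffeomorph (𝓡 n) (𝓡 n) ∞ p) {γ' : ℝ → M'} {t : ℝ}
    (hγ' : MDifferentiableAt 𝓘(ℝ, ℝ) (𝓡 n) γ' t) :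
    lift (fun s => p (γ' s)) t = tangentMap (𝓡 n) (𝓡 n) p (lift γ' t) := by
  refine congrArg (TotalSpace.mk (p (γ' t))) ?_
  have h : mfderiv 𝓘(ℝ, ℝ) (𝓡 n) (p ∘ γ') t = _ :=
    mfderiv_comp t ((hp (γ' t)).mdifferentiableAt (by simp)) hγ'
  exact congrArg (fun L => L (1 : ℝ)) h

lemma lift_comp_reparam {γ : ℝ → M} {φ : ℝ → ℝ} {t : ℝ}
    (hγ : MDifferentiableAt 𝓘(ℝ, ℝ) (𝓡 n) γ (φ t)) (hφ : DifferentiableAt ℝ φ t) :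
    lift (fun s => γ (φ s)) t = scale (deriv φ t) (lift (n := n) γ (φ t)) := by
  refine congrArg (TotalSpace.mk (γ (φ t))) ?_
  have h : mfderiv 𝓘(ℝ, ℝ) (𝓡 n) (γ ∘ φ) t = _ :=
    mfderiv_comp t hγ hφ.mdifferentiableAt
  refine (congrArg (fun L => L (1 : ℝ)) h).trans ?_
  have h2 : mfderiv 𝓘(ℝ, ℝ) 𝓘(ℝ, ℝ) φ t (1 : ℝ) = deriv φ t • (1 : ℝ) := by
    rw [mfderiv_eq_fderiv, smul_eq_mul, mul_one]
    exact fderiv_apply_one_eq_deriv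
  exact (congrArg (mfderiv 𝓘(ℝ, ℝ) (𝓡 n) γ (φ t)) h2).trans
    ((mfderiv 𝓘(ℝ, ℝ) (𝓡 n) γ (φ t)).map_smul (deriv φ t) (1 : ℝ))

/-- The curve `p ∘ γ'` on `J'` is the reparametrization by `φ` of the curve `γ` on `J`. -/
structure Covers (p : M' → M) (γ : ℝ → M) (J : Set ℝ) (γ' : ℝ → M') (J' : Set ℝ) (φ : ℝ → ℝ) :
    Prop where
  mapsTo : MapsTo φ J' J
  surjOn : SurjOn φ J' J
  monotone : StrictMonoOn φ J' ∨ StrictAntiOn φ J'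
  tangentMap_lift : ∀ t ∈ J', ∃ c ≠ (0 : ℝ),
    tangentMap (𝓡 n) (𝓡 n) p (lift γ' t) = scale c (lift (n := n) γ (φ t))

variable {cov : LinearConnection n M} {cov' : LinearConnection n M'} {p : M' → M}

lemma Covers.comp_eq {γ : ℝ → M} {J : Set ℝ} {γ' : ℝ → M'} {J' : Set ℝ} {φ : ℝ → ℝ}
    (h : Covers (n := n) p γ J γ' J' φ) {t : ℝ} (ht : t ∈ J') : p (γ' t) = γ (φ t) := by
  obtain ⟨c, -, h⟩ := h.tangentMap_lift t ht
  exact congrArg (fun u => u.1) h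

/-- The hypothesis on `p` compares images only. Nonreturning recovers the parameter: it makes `φ`
continuous, the immersion `γ` then makes it differentiable, and its derivative cannot vanish because
`dp` is injective on velocities. -/
lemma IsGeodesicCovering.exists_covers [T1Space M] (hp : IsGeodesicCovering cov' cov p)
    (hM : Nonreturning cov) {γ' : ℝ → M'} {J' : Set ℝ} (hγ' : IsGeodesic cov' γ' J') :
    ∃ (γ : ℝ → M) (J : Set ℝ) (φ : ℝ → ℝ), IsGeodesic cov γ J ∧ Covers (n := n) p γ J γ' J' φ := by
  obtain ⟨γ, J, hγ, himg⟩ := hp.image_geodesic γ' J' hγ'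
  have h1 : ∀ t ∈ J', ∃ s ∈ J, γ s = p (γ' t) := fun t ht =>
    himg.subset (mem_image_of_mem p (mem_image_of_mem γ' ht))
  choose! φ hφJ hφ using h1
  have hinj := hM.injOn hγ
  have hpc : Continuous p := hp.isLocalDiffeomorph.contMDiff.continuous
  have hφc : ∀ t ∈ J', ContinuousAt φ t := by
    intro t ht
    rw [Metric.continuousAt_iff']
    intro δ hδ
    obtain ⟨U, hU, hsub⟩ := hM.exists_nhds_subset_Ioo hγ (hφJ t ht) hδ
    have hc : ContinuousAt (fun s => p (γ' s)) t :=
      hpc.continuousAt.comp (hγ'.1.mdifferentiableAt ht).continuousAt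
    rw [hφ t ht] at hU
    filter_upwards [hc hU, hγ'.1.isOpen.mem_nhds ht] with s hs hsJ
    have := hsub ⟨hφJ s hsJ, by rw [mem_preimage, hφ s hsJ]; exact hs⟩
    rw [Real.dist_eq, abs_lt]
    constructor <;> linarith [this.1, this.2]
  have hloc : ∀ t ∈ J', (fun s => γ (φ s)) =ᶠ[𝓝 t] fun s => p (γ' s) := fun t ht => by
    filter_upwards [hγ'.1.isOpen.mem_nhds ht] with s hs using hφ s hs
  have hdiff : ∀ t ∈ J', MDifferentiableAt 𝓘(ℝ, ℝ) (𝓡 n) (fun s => p (γ' s)) t := fun t ht =>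
    ((hp.isLocalDiffeomorph (γ' t)).mdifferentiableAt (by simp)).comp t
      (hγ'.1.mdifferentiableAt ht)
  have hφd : ∀ t ∈ J', DifferentiableAt ℝ φ t := by
    intro t ht
    have hx : γ (φ t) ∈ (chartAt 𝔼 (γ (φ t))).source := mem_chart_source _ _
    have hx' : p (γ' t) ∈ (chartAt 𝔼 (γ (φ t))).source := by rw [hφ t ht] at hx ⊢; exact hx
    have hd := hasDerivAt_extChartAt_comp (hγ.1.mdifferentiableAt (hφJ t ht)) hx
    refine hasDerivAt_of_comp (c := fun s => extChartAt (𝓡 n) (γ (φ t)) (γ s))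
      ((contDiffAt_extChartAt_comp (hγ.1.isGeodesicAt (hφJ t ht)).contMDiffAt hx).of_le
        (by norm_num)) ?_ (hφc t ht) (hasDerivAt_extChartAt_comp (hdiff t ht) hx') ?_
    · rw [hd.deriv]
      exact coordVec_velocity_ne_zero hγ.1 (hφJ t ht) hx
    · filter_upwards [hloc t ht] with s hs using congrArg _ hs
  have hlift : ∀ t ∈ J', tangentMap (𝓡 n) (𝓡 n) p (lift γ' t) =
      scale (deriv φ t) (lift (n := n) γ (φ t)) := by
    intro t ht
    rw [← lift_comp hp.isLocalDiffeomorph (hγ'.1.mdifferentiableAt ht),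
      ← lift_comp_reparam (hγ.1.mdifferentiableAt (hφJ t ht)) (hφd t ht)]
    exact (lift_congr (hloc t ht).symm (hdiff t ht))
  have hne : ∀ t ∈ J', deriv φ t ≠ 0 := by
    intro t ht h0
    have h := tangentMap_snd_ne_zero hp.isLocalDiffeomorph (hγ'.lift_snd_ne_zero ht)
    rw [hlift t ht, h0] at h
    exact h (zero_smul ℝ (velocity (n := n) γ (φ t)))
  refine ⟨γ, J, φ, hγ, hφJ, ?_, ?_, fun t ht => ⟨_, hne t ht, hlift t ht⟩⟩
  -- Injectivity of `γ` turns equality of images into surjectivity of `φ` onto the whole domain of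
  -- `γ`.
  · intro s hs
    obtain ⟨_, ⟨t, ht, rfl⟩, h⟩ := himg.symm ▸ mem_image_of_mem γ hs
    exact ⟨t, ht, hinj (hφJ t ht) hs ((hφ t ht).trans h)⟩
  · exact strictMonoOn_or_strictAntiOn_of_deriv_ne_zero hγ'.1.isOpen hγ'.1.ordConnected hφd hne

lemma continuousAt_snd_trivialization {X Y I : Type*} [TopologicalSpace X] [TopologicalSpace Y]
    [TopologicalSpace I] {q : Y → X} (e : Trivialization I q) {y : Y} (hy : y ∈ e.source) :
    ContinuousAt (fun y => (e y).2) y := by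
  have h : ContinuousAt e y := e.toOpenPartialHomeomorph.continuousAt hy
  exact continuous_snd.continuousAt.comp h

/-- Points of a geodesic of the covering space over a nonreturning evenly covered set lie in the
same sheet. -/
lemma IsGeodesicCovering.sheet_eq [T1Space M] (hp : IsGeodesicCovering cov' cov p)
    (hM : Nonreturning cov) {I : Type*} [TopologicalSpace I] [DiscreteTopology I]
    (e : Trivialization I p) {U : Set M} (hUe : U ⊆ e.baseSet)
    (hU : ∀ (γ : ℝ → M) (J : Set ℝ), IsGeodesic cov γ J → (J ∩ γ ⁻¹' U).OrdConnected)
    {γ' : ℝ → M'} {J' : Set ℝ} (hγ' : IsGeodesic cov' γ' J') {s t : ℝ} (hs : s ∈ J') (ht : t ∈ J')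
    (hsU : p (γ' s) ∈ U) (htU : p (γ' t) ∈ U) : (e (γ' s)).2 = (e (γ' t)).2 := by
  obtain ⟨γ, J, φ, hγ, hc⟩ := hp.exists_covers hM hγ'
  -- The times above `U` are the preimage under the monotone `φ` of an interval, hence an interval.
  -- The sheet index is continuous there with discrete values, so it is constant.
  set A : Set ℝ := J' ∩ (fun t => p (γ' t)) ⁻¹' U
  have hA : A.OrdConnected := by
    have hord := hU γ J hγ
    refine ⟨fun a ha b hb r hr => ?_⟩
    have hrJ : r ∈ J' := hγ'.1.ordConnected.out ha.1 hb.1 hr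
    have hmem : ∀ q ∈ A, φ q ∈ J ∩ γ ⁻¹' U := fun q hq =>
      ⟨hc.mapsTo hq.1, by rw [mem_preimage, ← hc.comp_eq hq.1]; exact hq.2⟩
    refine ⟨hrJ, ?_⟩
    rw [mem_preimage, hc.comp_eq hrJ]
    rcases hc.monotone with h | h
    · exact (hord.out (hmem a ha) (hmem b hb)
        ⟨h.monotoneOn ha.1 hrJ hr.1, h.monotoneOn hrJ hb.1 hr.2⟩).2
    · exact (hord.out (hmem b hb) (hmem a ha)
        ⟨h.antitoneOn hrJ hb.1 hr.2, h.antitoneOn ha.1 hrJ hr.1⟩).2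
  have hcont : ContinuousOn (fun r => (e (γ' r)).2) A := by
    intro r hr
    have h1 : γ' r ∈ e.source := e.mem_source.2 (hUe hr.2)
    have h2 : ContinuousAt (fun x => (e x).2) (γ' r) := continuousAt_snd_trivialization e h1
    exact (ContinuousAt.comp (f := γ') h2
      (hγ'.1.mdifferentiableAt hr.1).continuousAt).continuousWithinAt
  exact hA.isPreconnected.constant hcont ⟨hs, hsU⟩ ⟨ht, htU⟩

end Covering

/-! ### The tangent map of a local diffeomorphism -/

section LocalDiffeomorph

lemma tangentMap_eq_self {f : M → M} {u : TangentBundle (𝓡 n) M} (h : f =ᶠ[𝓝 u.1] id) :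
    tangentMap (𝓡 n) (𝓡 n) f u = u := by
  have hf : f u.1 = u.1 := h.self_of_nhds
  have h1 := h.mfderiv_eq (I := 𝓡 n) (I' := 𝓡 n)
  refine TotalSpace.ext hf (heq_of_eq ?_)
  change mfderiv (𝓡 n) (𝓡 n) f u.1 u.2 = u.2
  rw [h1, mfderiv_id]
  rfl

variable {M' : Type*} [TopologicalSpace M'] [ChartedSpace (EuclideanSpace ℝ (Fin n)) M']
  [IsManifold (𝓡 n) ∞ M'] {p : M' → M}

lemma contMDiff_tangentMap (hp : IsLocalDiffeomorph (𝓡 n) (𝓡 n) ∞ p) :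
    ContMDiff (𝓡 n).tangent (𝓡 n).tangent ∞ (tangentMap (𝓡 n) (𝓡 n) p) :=
  haveI : IsManifold (𝓡 n) 1 M := IsManifold.of_le (n := ∞) (by simp)
  haveI : IsManifold (𝓡 n) 1 M' := IsManifold.of_le (n := ∞) (by simp)
  hp.contMDiff.contMDiff_tangentMap (by simp)

/-- The tangent map of a local diffeomorphism is locally invertible. -/
lemma exists_local_inverse_tangentMap (hp : IsLocalDiffeomorph (𝓡 n) (𝓡 n) ∞ p)
    (u : TangentBundle (𝓡 n) M') :
    ∃ σ : TangentBundle (𝓡 n) M → TangentBundle (𝓡 n) M',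
      ContMDiffAt (𝓡 n).tangent (𝓡 n).tangent ∞ σ (tangentMap (𝓡 n) (𝓡 n) p u) ∧
      σ (tangentMap (𝓡 n) (𝓡 n) p u) = u ∧
      ∀ᶠ v in 𝓝 (tangentMap (𝓡 n) (𝓡 n) p u), tangentMap (𝓡 n) (𝓡 n) p (σ v) = v := by
  have : IsManifold (𝓡 n) 1 M := IsManifold.of_le (n := ∞) (by simp)
  have : IsManifold (𝓡 n) 1 M' := IsManifold.of_le (n := ∞) (by simp)
  obtain ⟨Φ, hx, heq⟩ := hp u.1
  have hpΦ : ∀ x ∈ Φ.source, p x = Φ x := fun x hx => heq hx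
  have hTp : p u.1 ∈ Φ.target := by
    rw [hpΦ _ hx]
    exact Φ.map_source hx
  have hpd : ∀ x, MDifferentiableAt (𝓡 n) (𝓡 n) p x := fun x =>
    (hp x).mdifferentiableAt (by simp)
  have hsd : ∀ y ∈ Φ.target, MDifferentiableAt (𝓡 n) (𝓡 n) Φ.symm y := fun y hy =>
    Φ.symm.mdifferentiableAt (by simp) hy
  have hproj : Continuous (fun u : TangentBundle (𝓡 n) M => u.1) :=
    FiberBundle.continuous_proj 𝔼 (fun x : M => TangentSpace (𝓡 n) x)
  have hO : IsOpen ((fun u : TangentBundle (𝓡 n) M => u.1) ⁻¹' Φ.target) :=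
    Φ.open_target.preimage hproj
  refine ⟨tangentMap (𝓡 n) (𝓡 n) Φ.symm, ?_, ?_, ?_⟩
  · have h1 := Φ.symm.contMDiffOn.contMDiffOn_tangentMapWithin (m := ∞) (by simp)
      (Φ.open_target.uniqueMDiffOn (I := 𝓡 n))
    have h2 := h1.congr (f₁ := tangentMap (𝓡 n) (𝓡 n) Φ.symm) fun v hv =>
      (tangentMapWithin_eq_tangentMap ((Φ.open_target.uniqueMDiffOn (I := 𝓡 n)) _ hv)
        (hsd _ hv)).symm
    exact h2.contMDiffAt (hO.mem_nhds hTp)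
  · rw [← tangentMap_comp_at u (hsd _ hTp) (hpd _)]
    refine tangentMap_eq_self ?_
    filter_upwards [Φ.open_source.mem_nhds hx] with x hx
    change Φ.symm (p x) = x
    rw [hpΦ x hx]
    exact Φ.left_inv hx
  · filter_upwards [hO.mem_nhds hTp] with v hv
    rw [← tangentMap_comp_at v (hpd _) (hsd _ hv)]
    refine tangentMap_eq_self ?_
    filter_upwards [Φ.open_target.mem_nhds hv] with y hy
    change p (Φ.symm y) = y
    exact (hpΦ _ (Φ.map_target hy)).trans (Φ.right_inv hy)

/-- The map of reduced tangent bundles induced by a local diffeomorphism. -/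
def reducedTangentMap (hp : IsLocalDiffeomorph (𝓡 n) (𝓡 n) ∞ p)
    (u : ReducedTangentBundle n M') : ReducedTangentBundle n M :=
  ⟨tangentMap (𝓡 n) (𝓡 n) p u.1, tangentMap_snd_ne_zero hp u.2⟩

lemma contMDiff_reducedTangentMap (hp : IsLocalDiffeomorph (𝓡 n) (𝓡 n) ∞ p) :
    ContMDiff (𝓡 n).tangent (𝓡 n).tangent ∞ (reducedTangentMap hp) := fun u =>
  (ContMDiffAt.subtypeVal_comp_iff (ReducedTangentBundle n M) (reducedTangentMap hp) u).1
    ((contMDiff_tangentMap hp).comp contMDiff_subtype_val u)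

/-- The map of reduced tangent bundles is locally invertible. -/
lemma exists_local_inverse_reducedTangentMap (hp : IsLocalDiffeomorph (𝓡 n) (𝓡 n) ∞ p)
    (u : ReducedTangentBundle n M') :
    ∃ σ : ReducedTangentBundle n M → ReducedTangentBundle n M',
      ContMDiffAt (𝓡 n).tangent (𝓡 n).tangent ∞ σ (reducedTangentMap hp u) ∧
      σ (reducedTangentMap hp u) = u ∧
      ∀ᶠ v in 𝓝 (reducedTangentMap hp u), reducedTangentMap hp (σ v) = v := by
  classical
  obtain ⟨σ, hσ, hσu, hσr⟩ := exists_local_inverse_tangentMap hp u.1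
  let τ : ReducedTangentBundle n M → ReducedTangentBundle n M' := fun v =>
    if h : (σ v.1).2 ≠ 0 then ⟨σ v.1, h⟩ else u
  have hcomp : ContMDiffAt (𝓡 n).tangent (𝓡 n).tangent ∞
      (fun v : ReducedTangentBundle n M => σ v.1) (reducedTangentMap hp u) :=
    ContMDiffAt.comp (reducedTangentMap hp u) hσ contMDiff_subtype_val.contMDiffAt
  have hmem : ∀ᶠ v in 𝓝 (reducedTangentMap hp u), (τ v).1 = σ v.1 := by
    have h1 := hcomp.continuousAt.preimage_mem_nhds
      ((ReducedTangentBundle n M').isOpen.mem_nhds (by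
        change σ (tangentMap (𝓡 n) (𝓡 n) p u.1) ∈ _
        rw [hσu]
        exact u.2))
    filter_upwards [h1] with v hv
    have hv' : (σ v.1).2 ≠ 0 := hv
    simp only [τ, dif_pos hv']
  refine ⟨τ, ?_, ?_, ?_⟩
  · exact (ContMDiffAt.subtypeVal_comp_iff (ReducedTangentBundle n M') τ _).1
      (hcomp.congr_of_eventuallyEq hmem)
  · exact Subtype.ext (hmem.self_of_nhds.trans hσu)
  · filter_upwards [hmem, continuous_subtype_val.continuousAt.eventually hσr] with v hv hv'
    refine Subtype.ext ?_
    change tangentMap (𝓡 n) (𝓡 n) p (τ v).1 = v.1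
    rw [hv, hv']

lemma isOpenMap_reducedTangentMap (hp : IsLocalDiffeomorph (𝓡 n) (𝓡 n) ∞ p) :
    IsOpenMap (reducedTangentMap hp) := by
  refine IsOpenMap.of_nhds_le fun u => ?_
  obtain ⟨σ, hσ, hσu, hσr⟩ := exists_local_inverse_reducedTangentMap hp u
  intro s hs
  have h1 := hσ.continuousAt.preimage_mem_nhds (t := reducedTangentMap hp ⁻¹' s) (by
    rw [hσu]; exact hs)
  filter_upwards [h1, hσr] with v hv hv'
  rw [← hv']
  exact hv

end LocalDiffeomorph

/-! ### The induced map of spaces of geodesics -/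

section CoveringMap

variable {M' : Type*} [TopologicalSpace M'] [ChartedSpace (EuclideanSpace ℝ (Fin n)) M']
  [IsManifold (𝓡 n) ∞ M'] {cov : LinearConnection n M} {cov' : LinearConnection n M'} {p : M' → M}

lemma IsGeodesicCovering.tangent_tangentMap [T1Space M] (hp : IsGeodesicCovering cov' cov p)
    (hM : Nonreturning cov) {u v : TangentBundle (𝓡 n) M'} (h : Tangent cov' u v) :
    Tangent cov (tangentMap (𝓡 n) (𝓡 n) p u) (tangentMap (𝓡 n) (𝓡 n) p v) := by
  obtain ⟨γ', J', hγ', s, hs, t, ht, c, hc, d, hd, rfl, rfl⟩ := h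
  obtain ⟨γ, J, φ, hγ, hcov⟩ := hp.exists_covers hM hγ'
  obtain ⟨a, ha, hs'⟩ := hcov.tangentMap_lift s hs
  obtain ⟨b, hb, ht'⟩ := hcov.tangentMap_lift t ht
  exact ⟨γ, J, hγ, φ s, hcov.mapsTo hs, φ t, hcov.mapsTo ht, c * a, mul_ne_zero hc ha, d * b,
    mul_ne_zero hd hb, by rw [tangentMap_scale, hs', scale_scale],
    by rw [tangentMap_scale, ht', scale_scale]⟩

variable [T2Space M] [CovariantDerivative.ContMDiffCovariantDerivative cov ∞]
  [T2Space M'] [CovariantDerivative.ContMDiffCovariantDerivative cov' ∞]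

/-- If the projections of `u` and `v` are tangent to a common geodesic, then the geodesic through
`v` meets the fibre of the base point of `u`, and if it passes through that base point then it is
tangent to `u`. -/
lemma IsGeodesicCovering.exists_over (hp : IsGeodesicCovering cov' cov p) (hM : Nonreturning cov)
    {u v : TangentBundle (𝓡 n) M'} (hv : v.2 ≠ 0)
    (h : Tangent cov (tangentMap (𝓡 n) (𝓡 n) p u) (tangentMap (𝓡 n) (𝓡 n) p v)) :
    ∃ (γ' : ℝ → M') (J' : Set ℝ), IsGeodesic cov' γ' J' ∧ (0 : ℝ) ∈ J' ∧ lift γ' 0 = v ∧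
      ∃ t ∈ J', p (γ' t) = p u.1 ∧ (γ' t = u.1 → Tangent cov' u v) := by
  obtain ⟨γ', J', hγ', h0, hl⟩ := exists_isGeodesic cov' v hv
  obtain ⟨γ, J, φ, hγ, hcov⟩ := hp.exists_covers hM hγ'
  obtain ⟨a, ha, h1⟩ := hcov.tangentMap_lift 0 h0
  rw [hl] at h1
  obtain ⟨s, hs, d, hd, h2⟩ := h.symm.exists_eq hγ (hcov.mapsTo h0) ha h1
  -- The geodesic through `v` covers all of `γ`, so it reaches the parameter at which `γ` is tangent
  -- to `dp u`.
  obtain ⟨t, ht, rfl⟩ := hcov.surjOn hs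
  obtain ⟨b, hb, h3⟩ := hcov.tangentMap_lift t ht
  refine ⟨γ', J', hγ', h0, hl, t, ht, ?_, fun heq => ?_⟩
  · rw [hcov.comp_eq ht]
    exact (congrArg (fun w => w.1) h2).symm
  -- Both vectors sit at the same point and have proportional images, and `dp` is injective on the
  -- tangent space there.
  · have h4 : u = scale (d * b⁻¹) (lift γ' t) := by
      refine eq_of_tangentMap_eq hp.isLocalDiffeomorph heq.symm ?_
      rw [tangentMap_scale, h3, scale_scale, h2, mul_assoc, inv_mul_cancel₀ hb, mul_one]
    exact ⟨γ', J', hγ', t, ht, 0, h0, d * b⁻¹, mul_ne_zero hd (inv_ne_zero hb), 1, one_ne_zero, h4,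
      by rw [hl, scale_one]⟩

section Sheet

lemma eq_of_trivialization_snd_eq {X Y I : Type*} [TopologicalSpace X] [TopologicalSpace Y]
    [TopologicalSpace I] {q : Y → X} (e : Trivialization I q) {y z : Y} (hy : y ∈ e.source)
    (hz : z ∈ e.source) (h : q y = q z) (h' : (e y).2 = (e z).2) : y = z := by
  refine e.injOn hy hz (Prod.ext ?_ h')
  exact (e.coe_fst hy).trans (h.trans (e.coe_fst hz).symm)

variable {I : Type*} [TopologicalSpace I]

/-- The nonzero tangent vectors at points of the sheet `i` over the interior of `U`. -/
def sheetVectors (e : Trivialization I p) (U : Set M) (i : I) : Set (ReducedTangentBundle n M') :=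
  {w | p w.1.1 ∈ interior U ∧ (e w.1.1).2 = i}

omit [IsManifold (𝓡 n) ∞ M] [IsManifold (𝓡 n) ∞ M'] [T2Space M] [T2Space M'] in
lemma isOpen_sheetVectors [IsManifold (𝓡 n) ∞ M'] [DiscreteTopology I] (hp : Continuous p)
    (e : Trivialization I p) {U : Set M} (hUe : U ⊆ e.baseSet) (i : I) :
    IsOpen (sheetVectors (n := n) e U i) := by
  have hb : Continuous (fun u : ReducedTangentBundle n M' => u.1.1) :=
    (FiberBundle.continuous_proj 𝔼 (fun x : M' => TangentSpace (𝓡 n) x)).comp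
      continuous_subtype_val
  refine isOpen_iff_mem_nhds.2 fun w hw => ?_
  have h1 : ContinuousAt (fun x => (e x).2) w.1.1 :=
    continuousAt_snd_trivialization e (e.mem_source.2 (hUe (interior_subset hw.1)))
  have h2 : ContinuousAt (fun w : ReducedTangentBundle n M' => (e w.1.1).2) w :=
    ContinuousAt.comp (f := fun w : ReducedTangentBundle n M' => w.1.1) h1 hb.continuousAt
  filter_upwards [(hp.comp hb).continuousAt.preimage_mem_nhds (isOpen_interior.mem_nhds hw.1),
    h2.preimage_mem_nhds ((isOpen_discrete {i}).mem_nhds hw.2)] with v hv hv'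
  exact ⟨hv, hv'⟩

variable [DiscreteTopology I] (hp : IsGeodesicCovering cov' cov p) (hM : Nonreturning cov)
  (e : Trivialization I p) {U : Set M} (hUe : U ⊆ e.baseSet)
  (hU : ∀ (γ : ℝ → M) (J : Set ℝ), IsGeodesic cov γ J → (J ∩ γ ⁻¹' U).OrdConnected)

include hp hM hUe hU

/-- Keeps the images of different sheets in `G(M')` disjoint; this is what separates geodesics with
the same image in `G(M)`. -/
lemma sheet_eq_of_tangent {i j : I} {u v : ReducedTangentBundle n M'}
    (hu : u ∈ sheetVectors e U i) (hv : v ∈ sheetVectors e U j) (h : Tangent cov' u.1 v.1) :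
    i = j := by
  obtain ⟨γ', J', hγ', s, hs, t, ht, c, hc, d, hd, hus, hvt⟩ := h
  have h1 : u.1.1 = γ' s := congrArg (fun w => w.1) hus
  have h2 : v.1.1 = γ' t := congrArg (fun w => w.1) hvt
  rw [← hu.2, ← hv.2, h1, h2]
  exact hp.sheet_eq hM e hUe hU hγ' hs ht (h1 ▸ interior_subset hu.1) (h2 ▸ interior_subset hv.1)

/-- Local injectivity of the induced map: the geodesic through `v` passes over the base point of `u`
without leaving the sheet above `U`, hence passes through that base point itself. -/
lemma tangent_of_mem_sheetVectors {i : I} {u v : ReducedTangentBundle n M'}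
    (hu : u ∈ sheetVectors e U i) (hv : v ∈ sheetVectors e U i)
    (h : Tangent cov (tangentMap (𝓡 n) (𝓡 n) p u.1) (tangentMap (𝓡 n) (𝓡 n) p v.1)) :
    Tangent cov' u.1 v.1 := by
  obtain ⟨γ', J', hγ', h0, hl, t, ht, hpt, himp⟩ := hp.exists_over hM v.2 h
  have hv0 : γ' 0 = v.1.1 := congrArg (fun w => w.1) hl
  have huU := interior_subset hu.1
  have h1 := hp.sheet_eq hM e hUe hU hγ' ht h0 (by rw [hpt]; exact huU)
    (by rw [hv0]; exact interior_subset hv.1)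
  have hs : u.1.1 ∈ e.source := e.mem_source.2 (hUe huU)
  have hs' : γ' t ∈ e.source := e.mem_source.2 (by rw [hpt]; exact hUe huU)
  exact himp (eq_of_trivialization_snd_eq e hs' hs hpt (by rw [h1, hv0, hu.2, hv.2]))

end Sheet

omit [T2Space M'] [CovariantDerivative.ContMDiffCovariantDerivative cov' ∞]
  [CovariantDerivative.ContMDiffCovariantDerivative cov ∞] [T2Space M] in
/-- Every point has a nonreturning evenly covered neighbourhood. -/
lemma IsGeodesicCovering.exists_evenly_covered (hp : IsGeodesicCovering cov' cov p)
    (hM : Nonreturning cov) (x : M) :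
    ∃ (e : Trivialization (p ⁻¹' {x}) p) (U : Set M), DiscreteTopology (p ⁻¹' {x}) ∧ U ∈ 𝓝 x ∧
      U ⊆ e.baseSet ∧
      ∀ (γ : ℝ → M) (J : Set ℝ), IsGeodesic cov γ J → (J ∩ γ ⁻¹' U).OrdConnected := by
  have hne : Nonempty (p ⁻¹' {x}) := by
    obtain ⟨y, hy⟩ := hp.surjective x
    exact ⟨⟨y, hy⟩⟩
  have h := hp.isCoveringMap x
  obtain ⟨U, hU, hsub, hord⟩ := hM x h.toTrivialization.baseSet
    (h.toTrivialization.open_baseSet.mem_nhds h.mem_toTrivialization_baseSet)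
  exact ⟨h.toTrivialization, U, h.discreteTopology_fiber, hU, hsub, hord⟩

/-- The map of spaces of geodesics induced by a geodesic covering. -/
def geodesicSpaceMap (hp : IsGeodesicCovering cov' cov p) (g : GeodesicSpace cov') :
    -- Defined through an arbitrary tangent vector of the geodesic; independence of the choice needs
    -- the nonreturning hypothesis and is proved next.
    GeodesicSpace cov :=
  toGeodesicSpace cov (reducedTangentMap hp.isLocalDiffeomorph
    (Function.surjInv surjective_toGeodesicSpace g))

variable (hp : IsGeodesicCovering cov' cov p) (hM : Nonreturning cov)

include hM

lemma geodesicSpaceMap_toGeodesicSpace (u : ReducedTangentBundle n M') :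
    geodesicSpaceMap hp (toGeodesicSpace cov' u) =
      toGeodesicSpace cov (reducedTangentMap hp.isLocalDiffeomorph u) := by
  refine toGeodesicSpace_eq_iff.2 (hp.tangent_tangentMap hM ?_)
  exact toGeodesicSpace_eq_iff.1 (Function.surjInv_eq surjective_toGeodesicSpace _)

lemma continuous_geodesicSpaceMap : Continuous (geodesicSpaceMap hp) := by
  refine ((isOpenMap_toGeodesicSpace.isQuotientMap continuous_toGeodesicSpace
    surjective_toGeodesicSpace).continuous_iff).2 ?_
  have h : geodesicSpaceMap hp ∘ toGeodesicSpace cov' =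
      toGeodesicSpace cov ∘ reducedTangentMap hp.isLocalDiffeomorph :=
    funext fun u => geodesicSpaceMap_toGeodesicSpace hp hM u
  rw [h]
  exact continuous_toGeodesicSpace.comp (contMDiff_reducedTangentMap _).continuous

lemma isOpenMap_geodesicSpaceMap : IsOpenMap (geodesicSpaceMap hp) := by
  intro A hA
  have h : geodesicSpaceMap hp '' A = toGeodesicSpace cov ''
      (reducedTangentMap hp.isLocalDiffeomorph '' (toGeodesicSpace cov' ⁻¹' A)) := by
    rw [image_image, ← image_preimage_eq A surjective_toGeodesicSpace, image_image,
      preimage_image_preimage]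
    exact image_congr fun u _ => geodesicSpaceMap_toGeodesicSpace hp hM u
  rw [h]
  exact isOpenMap_toGeodesicSpace _ (isOpenMap_reducedTangentMap _ _
    (hA.preimage continuous_toGeodesicSpace))

/-- The map is continuous and open, and it is injective on the open set of geodesics that have a
tangent vector in one fixed sheet. -/
lemma isLocalHomeomorph_geodesicSpaceMap : IsLocalHomeomorph (geodesicSpaceMap hp) := by
  intro g
  obtain ⟨u, rfl⟩ := surjective_toGeodesicSpace g
  obtain ⟨e, U, hd, hU, hUe, hord⟩ := hp.exists_evenly_covered hM (p u.1.1)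
  let N : Set (ReducedTangentBundle n M') := sheetVectors e U (e u.1.1).2
  have hN : IsOpen N := isOpen_sheetVectors hp.isCoveringMap.continuous e hUe _
  have hinj : InjOn (geodesicSpaceMap hp) (toGeodesicSpace cov' '' N) := by
    rintro _ ⟨v, hv, rfl⟩ _ ⟨w, hw, rfl⟩ h
    rw [geodesicSpaceMap_toGeodesicSpace hp hM, geodesicSpaceMap_toGeodesicSpace hp hM] at h
    exact toGeodesicSpace_eq_iff.2 (tangent_of_mem_sheetVectors hp hM e hUe hord hv hw
      (toGeodesicSpace_eq_iff.1 h))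
  have : Nonempty (GeodesicSpace cov') := ⟨toGeodesicSpace cov' u⟩
  exact ⟨OpenPartialHomeomorph.ofContinuousOpen hinj.toPartialEquiv
    (continuous_geodesicSpaceMap hp hM).continuousOn (isOpenMap_geodesicSpaceMap hp hM)
    (isOpenMap_toGeodesicSpace N hN),
    ⟨u, ⟨mem_interior_iff_mem_nhds.2 hU, rfl⟩, rfl⟩, rfl⟩

include hp in
lemma t2Space_geodesicSpace [T2Space (GeodesicSpace cov)] : T2Space (GeodesicSpace cov') := by
  refine ⟨fun g₁ g₂ hne => ?_⟩
  by_cases hP : geodesicSpaceMap hp g₁ = geodesicSpaceMap hp g₂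
  swap
  · obtain ⟨A, B, hA, hB, h1, h2, hAB⟩ := t2_separation hP
    have hc := continuous_geodesicSpaceMap hp hM
    exact ⟨_, _, hA.preimage hc, hB.preimage hc, h1, h2, hAB.preimage _⟩
  obtain ⟨u, rfl⟩ := surjective_toGeodesicSpace g₁
  obtain ⟨v, rfl⟩ := surjective_toGeodesicSpace g₂
  rw [geodesicSpaceMap_toGeodesicSpace hp hM, geodesicSpaceMap_toGeodesicSpace hp hM] at hP
  obtain ⟨γ', J', hγ', h0, hl, t, ht, hpt, himp⟩ :=
    hp.exists_over hM v.2 (toGeodesicSpace_eq_iff.1 hP)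
  -- The second geodesic passes over the base point of `u` at a different point of the fibre, hence
  -- in a different sheet. The geodesics meeting these two sheets over `U` form disjoint open sets.
  have hne' : γ' t ≠ u.1.1 := fun h => hne (toGeodesicSpace_eq_iff.2 (himp h))
  let w : ReducedTangentBundle n M' := ⟨lift γ' t, hγ'.lift_snd_ne_zero ht⟩
  have hw : toGeodesicSpace cov' w = toGeodesicSpace cov' v := by
    refine toGeodesicSpace_eq_iff.2 ?_
    rw [← hl]
    exact tangent_lift hγ' ht h0
  obtain ⟨e, U, hd, hU, hUe, hord⟩ := hp.exists_evenly_covered hM (p u.1.1)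
  have hxU := mem_interior_iff_mem_nhds.2 hU
  have hs : u.1.1 ∈ e.source := e.mem_source.2 (hUe (interior_subset hxU))
  have hs' : γ' t ∈ e.source := e.mem_source.2 (by rw [hpt]; exact hUe (interior_subset hxU))
  have hsheet : (e u.1.1).2 ≠ (e (γ' t)).2 := fun h =>
    hne' (eq_of_trivialization_snd_eq e hs' hs hpt h.symm)
  have hcp := hp.isCoveringMap.continuous
  refine ⟨_, _, isOpenMap_toGeodesicSpace _ (isOpen_sheetVectors hcp e hUe (e u.1.1).2),
    isOpenMap_toGeodesicSpace _ (isOpen_sheetVectors hcp e hUe (e (γ' t)).2),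
    ⟨u, ⟨hxU, rfl⟩, rfl⟩, ⟨w, ⟨?_, rfl⟩, hw⟩, ?_⟩
  · change p (γ' t) ∈ _
    rw [hpt]
    exact hxU
  · rw [disjoint_left]
    rintro _ ⟨a, ha, rfl⟩ ⟨b, hb, hab⟩
    exact hsheet (sheet_eq_of_tangent hp hM e hUe hord ha hb (toGeodesicSpace_eq_iff.1 hab.symm))

end CoveringMap

/-! ### Pulling back a smooth structure along a local homeomorphism -/

section LocalHomeomorph

variable {X Y : Type*} [TopologicalSpace X] [TopologicalSpace Y] {m : ℕ} {f : X → Y}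

/-- The charts of `Y`, pulled back along a local homeomorphism `f : X → Y`. -/
def pullbackChart (hf : IsLocalHomeomorph f) [ChartedSpace (EuclideanSpace ℝ (Fin m)) Y] (x : X) :
    OpenPartialHomeomorph X (EuclideanSpace ℝ (Fin m)) :=
  (hf.localInverseAt x).symm ≫ₕ chartAt (EuclideanSpace ℝ (Fin m)) (f x)

lemma pullbackChart_apply (hf : IsLocalHomeomorph f) [ChartedSpace (EuclideanSpace ℝ (Fin m)) Y]
    (x y : X) : pullbackChart (m := m) hf x y =
      chartAt (EuclideanSpace ℝ (Fin m)) (f x) (f y) := by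
  simp [pullbackChart]

/-- The charted space structure pulled back along a local homeomorphism. -/
@[reducible]
def pullbackChartedSpace (hf : IsLocalHomeomorph f)
    [ChartedSpace (EuclideanSpace ℝ (Fin m)) Y] :
    ChartedSpace (EuclideanSpace ℝ (Fin m)) X where
  atlas := range (pullbackChart hf)
  chartAt := pullbackChart hf
  mem_chart_source x := by simp [pullbackChart]
  chart_mem_atlas x := mem_range_self x

lemma isManifold_pullback (hf : IsLocalHomeomorph f)
    [ChartedSpace (EuclideanSpace ℝ (Fin m)) Y] [IsManifold (𝓡 m) ∞ Y] :
    letI := pullbackChartedSpace (m := m) hf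
    IsManifold (𝓡 m) ∞ X := by
  let := pullbackChartedSpace (m := m) hf
  refine isManifold_of_contDiffOn _ _ _ ?_
  rintro _ _ ⟨x, rfl⟩ ⟨y, rfl⟩
  -- Since `f` undoes its local inverses, the transition maps upstairs are restrictions of
  -- transition maps of `Y`.
  have key : ∀ z ∈ (𝓡 m).symm ⁻¹' ((pullbackChart (m := m) hf x).symm ≫ₕ
      pullbackChart (m := m) hf y).source ∩ range (𝓡 m),
      z ∈ (chartAt (EuclideanSpace ℝ (Fin m)) (f x)).target ∧
      f (hf.localInverseAt x ((chartAt (EuclideanSpace ℝ (Fin m)) (f x)).symm z)) =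
        (chartAt (EuclideanSpace ℝ (Fin m)) (f x)).symm z ∧
      f (hf.localInverseAt x ((chartAt (EuclideanSpace ℝ (Fin m)) (f x)).symm z)) ∈
        (chartAt (EuclideanSpace ℝ (Fin m)) (f y)).source := by
    rintro z ⟨hz, -⟩
    simp only [pullbackChart, mfld_simps] at hz
    exact ⟨hz.1.1, hf.apply_localInverseAt_of_mem hz.1.2, by simpa using hz.2.2⟩
  refine ((contDiffOn_ext_coord_change (I := 𝓡 m) (n := ∞) (f y) (f x)).mono ?_).congr ?_
  · intro z hz
    obtain ⟨h1, h2, h3⟩ := key z hz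
    rw [h2] at h3
    simpa only [mfld_simps] using ⟨h1, h3⟩
  · intro z hz
    obtain ⟨h1, h2, h3⟩ := key z hz
    have h4 : (pullbackChart (m := m) hf y) ((pullbackChart (m := m) hf x).symm z) =
        chartAt (EuclideanSpace ℝ (Fin m)) (f y)
          ((chartAt (EuclideanSpace ℝ (Fin m)) (f x)).symm z) := by
      rw [pullbackChart_apply, ← h2]
      simp [pullbackChart]
    simpa only [mfld_simps] using h4

lemma extChartAt_pullback (hf : IsLocalHomeomorph f) [ChartedSpace (EuclideanSpace ℝ (Fin m)) Y]
    (x : X) :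
    letI := pullbackChartedSpace (m := m) hf
    ⇑(extChartAt (𝓡 m) x) = extChartAt (𝓡 m) (f x) ∘ f := by
  let := pullbackChartedSpace (m := m) hf
  funext y
  simp only [mfld_simps]
  exact pullbackChart_apply hf x y

lemma contMDiff_pullback (hf : IsLocalHomeomorph f) [ChartedSpace (EuclideanSpace ℝ (Fin m)) Y] :
    letI := pullbackChartedSpace (m := m) hf
    ContMDiff (𝓡 m) (𝓡 m) ∞ f := by
  let := pullbackChartedSpace (m := m) hf
  intro x
  refine contMDiffAt_iff_target.2 ⟨hf.continuous.continuousAt, ?_⟩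
  rw [← extChartAt_pullback hf]
  exact contMDiffAt_extChartAt

/-- A pulled back chart is a chart of `Y` composed with `f`, so `g` and `f ∘ g` have literally the
same coordinate expressions. -/
lemma contMDiff_of_comp_pullback (hf : IsLocalHomeomorph f)
    [ChartedSpace (EuclideanSpace ℝ (Fin m)) Y] {E H N : Type*} [NormedAddCommGroup E]
    [NormedSpace ℝ E] [TopologicalSpace H] {J : ModelWithCorners ℝ E H} [TopologicalSpace N]
    [ChartedSpace H N] {g : N → X} (hg : Continuous g) (h : ContMDiff J (𝓡 m) ∞ (f ∘ g)) :
    letI := pullbackChartedSpace (m := m) hf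
    ContMDiff J (𝓡 m) ∞ g := by
  let := pullbackChartedSpace (m := m) hf
  intro x
  refine contMDiffAt_iff_target.2 ⟨hg.continuousAt, ?_⟩
  rw [extChartAt_pullback hf]
  exact (contMDiffAt_iff_target.1 (h x)).2

end LocalHomeomorph

/-! ### Transfer of the manifold properties -/

section Topological

/-- If the composition of a linear endomorphism of a finite-dimensional space with a linear map is
surjective, then so is that linear map. -/
lemma surjective_of_comp_surjective {V W : Type*} [AddCommGroup V] [Module ℝ V]
    [TopologicalSpace V] [AddCommGroup W] [Module ℝ W] [TopologicalSpace W]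
    [FiniteDimensional ℝ W] (A : W →L[ℝ] W) (B : V →L[ℝ] W)
    (h : Function.Surjective (A.comp B)) : Function.Surjective B := by
  -- Surjectivity of the composition makes the endomorphism `A` surjective, hence injective by
  -- finite dimension, and it can be cancelled.
  have hA : Function.Injective A := (LinearMap.injective_iff_surjective (f := (A : W →ₗ[ℝ] W))).2
    (Function.Surjective.of_comp (g := B) h)
  intro w
  obtain ⟨v, hv⟩ := h (A w)
  exact ⟨v, hA hv⟩

variable {M' : Type*} [TopologicalSpace M'] [ChartedSpace (EuclideanSpace ℝ (Fin n)) M']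
  [IsManifold (𝓡 n) ∞ M'] {cov : LinearConnection n M} {cov' : LinearConnection n M'} {p : M' → M}
  [T2Space M] [CovariantDerivative.ContMDiffCovariantDerivative cov ∞]
  [T2Space M'] [CovariantDerivative.ContMDiffCovariantDerivative cov' ∞]
  (hp : IsGeodesicCovering cov' cov p) (hM : Nonreturning cov)

include hp hM

lemma isTopologicalManifold_geodesicSpace_of_covering [ParacompactSpace M'] [ConnectedSpace M']
    (h : IsTopologicalManifold (GeodesicSpace cov)) :
    IsTopologicalManifold (GeodesicSpace cov') := by
  have := h.t2
  obtain ⟨m, ⟨hch⟩⟩ := h.locallyEuclidean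
  have hloc := isLocalHomeomorph_geodesicSpaceMap hp hM
  let := pullbackChartedSpace (m := m) hloc
  have ht2 := t2Space_geodesicSpace hp hM
  have hne : Nonempty (GeodesicSpace cov') := by
    obtain ⟨g⟩ := h.connected.toNonempty
    obtain ⟨u, -⟩ := surjective_toGeodesicSpace g
    obtain ⟨x⟩ := (inferInstance : ConnectedSpace M').toNonempty
    exact ⟨toGeodesicSpace cov' ⟨⟨x, (u.1.2 : 𝔼)⟩, u.2⟩⟩
  have hsc := secondCountableTopology_geodesicSpace cov'
  have hlc : LocallyCompactSpace (GeodesicSpace cov') :=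
    ChartedSpace.locallyCompactSpace (EuclideanSpace ℝ (Fin m)) _
  -- Paracompactness follows from second countability, local compactness and the Hausdorff property.
  exact ⟨ht2, inferInstance, connectedSpace_geodesicSpace cov', m, ⟨inferInstance⟩⟩

lemma geodesicSpaceIsSmoothManifold_of_covering [ParacompactSpace M'] [ConnectedSpace M']
    (h : GeodesicSpaceIsSmoothManifold cov) : GeodesicSpaceIsSmoothManifold cov' := by
  obtain ⟨htop, m, hch, hman, hsmooth, hsub⟩ := h
  have hloc := isLocalHomeomorph_geodesicSpaceMap hp hM
  let := pullbackChartedSpace (m := m) hloc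
  have hman' : IsManifold (𝓡 m) ∞ (GeodesicSpace cov') := isManifold_pullback hloc
  have hcomp : geodesicSpaceMap hp ∘ toGeodesicSpace cov' =
      toGeodesicSpace cov ∘ reducedTangentMap hp.isLocalDiffeomorph :=
    funext fun u => geodesicSpaceMap_toGeodesicSpace hp hM u
  have hdp := contMDiff_reducedTangentMap hp.isLocalDiffeomorph
  have hπ : ContMDiff (𝓡 n).tangent (𝓡 m) ∞ (toGeodesicSpace cov') :=
    contMDiff_of_comp_pullback hloc continuous_toGeodesicSpace (hcomp ▸ hsmooth.comp hdp)
  refine ⟨isTopologicalManifold_geodesicSpace_of_covering hp hM htop, m, inferInstance, hman', hπ,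
    fun u => ?_⟩
  have hP := contMDiff_pullback (m := m) hloc
  obtain ⟨σ, hσ, hσu, hσr⟩ := exists_local_inverse_reducedTangentMap hp.isLocalDiffeomorph u
  set F := reducedTangentMap hp.isLocalDiffeomorph
  have hFd : MDifferentiableAt (𝓡 n).tangent (𝓡 n).tangent F u :=
    (hdp u).mdifferentiableAt (by simp)
  -- Differentiating `F ∘ σ = id` near `F u` gives a right inverse of the differential of `F`.
  have hFsurj : Function.Surjective (mfderiv (𝓡 n).tangent (𝓡 n).tangent F u) := by
    have hFσ : MDifferentiableAt (𝓡 n).tangent (𝓡 n).tangent F (σ (F u)) := hσu.symm ▸ hFd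
    have h1 := mfderiv_comp (F u) hFσ (hσ.mdifferentiableAt (by simp))
    have h2 : F ∘ σ =ᶠ[𝓝 (F u)] id := hσr
    rw [h2.mfderiv_eq, mfderiv_id, hσu] at h1
    intro w
    exact ⟨mfderiv (𝓡 n).tangent (𝓡 n).tangent σ (F u) w,
      (congrArg (fun L => L w) h1).symm⟩
  have hπd : MDifferentiableAt (𝓡 n).tangent (𝓡 m) (toGeodesicSpace cov') u :=
    (hπ u).mdifferentiableAt (by simp)
  -- The chain rule for the two sides of `P ∘ π' = π ∘ F` expresses a surjective map as the
  -- differential of `P` after that of `π'`. The former is an endomorphism of the model space and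
  -- can be cancelled.
  have h1 := mfderiv_comp u ((hP (toGeodesicSpace cov' u)).mdifferentiableAt (by simp)) hπd
  have h2 := mfderiv_comp u ((hsmooth (F u)).mdifferentiableAt (by simp)) hFd
  rw [hcomp, h2] at h1
  have h3 : Function.Surjective ((mfderiv (𝓡 m) (𝓡 m) (geodesicSpaceMap hp)
      (toGeodesicSpace cov' u)).comp
        (mfderiv (𝓡 n).tangent (𝓡 m) (toGeodesicSpace cov') u)) := by
    rw [← h1]
    exact (hsub (F u)).comp hFsurj
  exact surjective_of_comp_surjective (V := 𝔼 × 𝔼) (W := EuclideanSpace ℝ (Fin m)) _ _ h3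

end Topological

end GeodesicSpaces

end

theorem mainTheorem7 {n : ℕ}
    {M M' : Type*}
    [TopologicalSpace M] [ChartedSpace (EuclideanSpace ℝ (Fin n)) M] [IsManifold (𝓡 n) ∞ M]
    [T2Space M] [ParacompactSpace M] [ConnectedSpace M]
    [TopologicalSpace M'] [ChartedSpace (EuclideanSpace ℝ (Fin n)) M'] [IsManifold (𝓡 n) ∞ M']
    [T2Space M'] [ParacompactSpace M'] [ConnectedSpace M']
    (cov : GeodesicSpaces.LinearConnection n M) [CovariantDerivative.ContMDiffCovariantDerivative cov ∞]
    (cov' : GeodesicSpaces.LinearConnection n M') [CovariantDerivative.ContMDiffCovariantDerivative cov' ∞]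
    (p : M' → M) (hp : GeodesicSpaces.IsGeodesicCovering cov' cov p)
    (hM : GeodesicSpaces.Nonreturning cov) :
    (GeodesicSpaces.IsTopologicalManifold (GeodesicSpaces.GeodesicSpace cov) →
      GeodesicSpaces.IsTopologicalManifold (GeodesicSpaces.GeodesicSpace cov')) ∧
    (GeodesicSpaces.GeodesicSpaceIsSmoothManifold cov →
      GeodesicSpaces.GeodesicSpaceIsSmoothManifold cov') := by
  exact ⟨GeodesicSpaces.isTopologicalManifold_geodesicSpace_of_covering hp hM,
    GeodesicSpaces.geodesicSpaceIsSmoothManifold_of_covering hp hM⟩
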